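/- Let $L=a_4(x)D^4+a_3(x)D^3+a_2(x)D^2+a_1(x)D$ be a differential operator with real polynomial coefficients, $\deg a_k\le k$ and $a_4\neq 0$. Let $I\subseteq\mathbb R$ be a non-empty open interval (bounded or not), and let $p=\frac{1}{|a_4|}\exp\left(\frac12\int\frac{a_3}{a_4}\,dx\right)$ on each subinterval of $I$ free of zeros of $a_4$ (with an arbitrary constant of integration on each of them). The weight $p$ is called admissible if $\int_I p\,u\,dx$ converges absolutely for every polynomial $u$. Let $\mathcal D$ be any set of $C^\infty$ functions on $\mathbb R$ all of whose derivatives have at most polynomial growth, containing all polynomials; $L$ is called self-adjoint on $I$ with weight $p$ if $\int_I p\,(Lu)\,v\,dx=\int_I p\,u\,(Lv)\,dx$ for all $u,v\in\mathcal D$. Writing $L$ in a new variable $y$, $x=ry+s$ ($r\ne0$), means replacing $a_k(x)$ by $r^{-k}a_k(ry+s)$, $I$ by $\{y: ry+s\in I\}$ and $p$ by $p(ry+s)$. **Classification.** The triples $(L,I,p)$ such that $p$ is admissible and $L$ is self-adjoint on $I$ with weight $p$ are exactly the following (in particular they do not depend on the choice of $\mathcal D$). 1. If $a_4$ has no real root: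 $(L,I,p)$ is such a triple if and only if $I=\mathbb R$ and, for some real $m_0,m_1,m_2,A$ with $m_2\neq0$, some non-zero constant multiple of $L$ has $$a_4=1,\quad a_3=2(m_1-2m_2^2x),\quad a_2=4m_2^4x^2-4m_1m_2^2x+A,\quad a_1=(-m_1^2+2m_2^2+A)(m_1-2m_2^2x),$$ and $p(x)=e^{-m_2^2x^2+m_1x+m_0}$. 2. If $a_4$ has exactly one real root: $(L,I,p)$ is such a triple if and only if, after an affine change of variable and multiplication of $L$ by a non-zero constant and of $p$ by a positive constant, $I=(0,\infty)$ and, for some real $a>2$, $b<0$ and $A$, $$a_4=x^2,\quad a_3=x(a+bx),\quad a_2=\tfrac14\left[-2a+a^2+x(4A+b^2x)\right],\quad a_1=\tfrac14(2A-ab)(-2+a+bx),$$ and $p(x)=|x|^{\frac a2-2}e^{\frac b2x}$. 3. If $a_4$ has more than one real root: $(L,I,p)$ is such a triple if and only if, after an affine change of variable and multiplication of $L$ by a non-zero constant and of $p$ by a positive constant, $I=(-1,1)$, $a_4=(1-x^2)^2$ and one of the following holds. (a) For some real $a<0$ and $A$: $a_3=-2(-2+a)x(-1+x^2)$, $a_2=-2a+a^2+A(-1+x^2)$,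 $a_1=a(2-3a+a^2-A)x$, and $p(x)=(1-x^2)^{-1-\frac a2}$. (b) For some real $a,b,B$ with $b\ne0$, $b-a>0$, $b+a<0$: $a_3=-2(b+(-2+a)x)(-1+x^2)$, $$a_2=\frac{b^3+B+2(-1+a)b^2x-Bx^2+b(-2+a+2x^2-3ax^2+a^2x^2)}{b},\quad a_1=B+\frac{aBx}{b},$$ and $p(x)=(1-x)^{\frac12(-2-a-b)}(1+x)^{\frac12(-2-a+b)}$. **Eigenvalues.** Each of the operators displayed above has, for every $n\ge0$, a polynomial eigenfunction of degree $n$, and every polynomial eigenfunction of degree $n$ has eigenvalue $\lambda_n$, where - in case 1, $\lambda_n=2m_2^2\left(m_1^2-A+2m_2^2(n-2)\right)n$; - in case 2, $\lambda_n=\frac b4\,n\,(2A-ab-b+bn)$; - in case 3(a), $\lambda_n=n(-a+n-1)(-a^2-na+4a+n^2+A-n-2)$; - in case 3(b), $\lambda_n=\dfrac{(a-n+1)\,n\,(-bn^2+abn+bn-ab+B)}{b}$. -/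

import Mathlib

open Polynomial MeasureTheory Set

noncomputable section

/-- The linear differential operator `a₄ D⁴ + a₃ D³ + a₂ D² + a₁ D`, given by its real polynomial
coefficients. -/
@[ext]
structure DiffOp4 where
  a₁ : ℝ[X]
  a₂ : ℝ[X]
  a₃ : ℝ[X]
  a₄ : ℝ[X]

namespace DiffOp4

/-- The function `L u = a₄ u'''' + a₃ u''' + a₂ u'' + a₁ u'`. -/
def act (L : DiffOp4) (u : ℝ → ℝ) (x : ℝ) : ℝ :=
  L.a₄.eval x * iteratedDeriv 4 u x + L.a₃.eval x * iteratedDeriv 3 u x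
    + L.a₂.eval x * iteratedDeriv 2 u x + L.a₁.eval x * deriv u x

/-- `L` has order exactly four, and `deg a_k ≤ k` for every `k`. -/
def IsOrderFour (L : DiffOp4) : Prop :=
  L.a₄ ≠ 0 ∧ L.a₁.natDegree ≤ 1 ∧ L.a₂.natDegree ≤ 2 ∧ L.a₃.natDegree ≤ 3 ∧ L.a₄.natDegree ≤ 4

/-- The operator `κ L`. -/
def scale (κ : ℝ) (L : DiffOp4) : DiffOp4 where
  a₁ := C κ * L.a₁
  a₂ := C κ * L.a₂
  a₃ := C κ * L.a₃
  a₄ := C κ * L.a₄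

/-- The operator `L` written in the new variable `y`, where `x = r y + s` (and `r ≠ 0`):
`d/dx = r⁻¹ d/dy`, so the coefficient `a_k (x)` becomes `r⁻ᵏ a_k (r y + s)`. -/
def affine (r s : ℝ) (L : DiffOp4) : DiffOp4 where
  a₁ := C (r⁻¹) * L.a₁.comp (C r * X + C s)
  a₂ := C (r⁻¹ ^ 2) * L.a₂.comp (C r * X + C s)
  a₃ := C (r⁻¹ ^ 3) * L.a₃.comp (C r * X + C s)
  a₄ := C (r⁻¹ ^ 4) * L.a₄.comp (C r * X + C s)

/-- `p = exp (½ ∫ a₃ / a₄) / |a₄|` on every subinterval of `I` that has no zero of `a₄`; the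
indefinite integral `F` may be chosen independently on these subintervals. -/
def IsWeight (L : DiffOp4) (I : Set ℝ) (p : ℝ → ℝ) : Prop :=
  ∃ F : ℝ → ℝ, ∀ x ∈ I, L.a₄.eval x ≠ 0 →
    HasDerivAt F (L.a₃.eval x / L.a₄.eval x) x ∧
      p x = Real.exp (F x / 2) / |L.a₄.eval x|

end DiffOp4

/-- The weight `p` is admissible on `I`: all polynomials are integrable against it. -/
def AdmissibleWeight (I : Set ℝ) (p : ℝ → ℝ) : Prop :=
  ∀ q : ℝ[X], IntegrableOn (fun x => p x * q.eval x) I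

namespace DiffOp4

/-- `⟨L u, v⟩ = ⟨u, L v⟩` for all `u, v ∈ 𝒟`, where `⟨f, g⟩ = ∫_I p f g`. -/
def SymmetricOn (𝒟 : Set (ℝ → ℝ)) (L : DiffOp4) (I : Set ℝ) (p : ℝ → ℝ) : Prop :=
  ∀ u ∈ 𝒟, ∀ v ∈ 𝒟,
    ∫ x in I, p x * L.act u x * v x = ∫ x in I, p x * u x * L.act v x

/-- `L` is a fourth-order operator with `deg a_k ≤ k` that is self-adjoint on the open interval `I`
(bounded or not) with the admissible weight `p = exp (½ ∫ a₃ / a₄) / |a₄|`, where `𝒟` is the space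
of functions on which self-adjointness is tested. -/
structure SelfAdjointWith (𝒟 : Set (ℝ → ℝ)) (L : DiffOp4) (I : Set ℝ) (p : ℝ → ℝ) : Prop where
  order_four : L.IsOrderFour
  isOpen : IsOpen I
  ordConnected : I.OrdConnected
  nonempty : I.Nonempty
  weight : L.IsWeight I p
  admissible : AdmissibleWeight I p
  symmetric : L.SymmetricOn 𝒟 I p

/-- The eigenvalues of `L` on polynomials are the numbers `lam n`: there is an eigenpolynomial of
every degree `n`, and every eigenpolynomial of degree `n` belongs to the eigenvalue `lam n`. -/
def HasEigenvalues (L : DiffOp4) (lam : ℕ → ℝ) : Prop :=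
  (∀ n : ℕ, ∃ y : ℝ[X], y ≠ 0 ∧ y.natDegree = n ∧
    ∀ x, L.act (fun t => y.eval t) x = lam n * y.eval x) ∧
  ∀ (y : ℝ[X]) (μ : ℝ), y ≠ 0 →
    (∀ x, L.act (fun t => y.eval t) x = μ * y.eval x) → μ = lam y.natDegree

end DiffOp4

/-- The family with `a₄ = 1`. -/
def hermiteOp (m₁ m₂ A : ℝ) : DiffOp4 where
  a₄ := 1
  a₃ := C 2 * (C m₁ - C (2 * m₂ ^ 2) * X)
  a₂ := C (4 * m₂ ^ 4) * X ^ 2 - C (4 * m₁ * m₂ ^ 2) * X + C A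
  a₁ := C (-m₁ ^ 2 + 2 * m₂ ^ 2 + A) * (C m₁ - C (2 * m₂ ^ 2) * X)

/-- The family with `a₄ = x²`. -/
def laguerreOp (a b A : ℝ) : DiffOp4 where
  a₄ := X ^ 2
  a₃ := X * (C a + C b * X)
  a₂ := C (1 / 4) * (C (-2 * a + a ^ 2) + X * (C (4 * A) + C (b ^ 2) * X))
  a₁ := C ((2 * A - a * b) / 4) * (C (-2 + a) + C b * X)

/-- The family with `a₄ = (1 - x²)²` and `a₃` odd. -/
def gegenbauerOp (a A : ℝ) : DiffOp4 where
  a₄ := (1 - X ^ 2) ^ 2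
  a₃ := C (-2 * (-2 + a)) * X * (-1 + X ^ 2)
  a₂ := C (-2 * a + a ^ 2) + C A * (-1 + X ^ 2)
  a₁ := C (a * (2 - 3 * a + a ^ 2 - A)) * X

/-- The family with `a₄ = (1 - x²)²` and `a₃` not odd; here `b ≠ 0`. -/
def jacobiOp (a b B : ℝ) : DiffOp4 where
  a₄ := (1 - X ^ 2) ^ 2
  a₃ := C (-2) * (C b + C (-2 + a) * X) * (-1 + X ^ 2)
  a₂ := C (1 / b) * (C (b ^ 3 + B) + C (2 * (-1 + a) * b ^ 2) * X - C B * X ^ 2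
    + C b * (C (-2 + a) + C (2 - 3 * a + a ^ 2) * X ^ 2))
  a₁ := C B + C (a * B / b) * X

end

/-!
For the test functions `x ^ i * q`, the triple commutator `[[[L, x], x], x] = 24 a₄ D + 6 a₃` turns
the symmetry of `L` into `∫ p (2 a₄ q' + a₃ q) = 0` for every polynomial `q`, a weak form of the
differential equation of `p`. Integration by parts then yields the formal symmetry
`p L u = (p a₄ u'')'' + (p g u')'`, whose consistency condition `p a₁ = (p g)'` is a polynomial
identity between the coefficients of `L`. At a finite end of `I` the boundary terms of these
identities vanish, which forces a zero of `a₄` of order at least two; at an infinite end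
integrability of `p` bounds the degree of `a₄` by that of `a₃`. Up to a constant and an affine
change of variable, `a₄` is therefore the square of `q = 1`, `x` or `1 - x²`, and the remaining
coefficient identities say that `L = T² + c T` for a hypergeometric operator `T = q D² + τ D`, of
Hermite, Laguerre or Jacobi type, whose Pearson equation `(p q)' = p τ` determines `p` up to a
factor.

Conversely, Pearson's equation together with `p q → 0` at the finite ends makes `T`, hence
`T² + c T`, symmetric. The eigenvalues are the diagonal coefficients of the triangular action of
`L` on polynomials; symmetry turns the orthogonal polynomials of `p` into eigenfunctions.
-/

noncomputable section

open Filter Topology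

section AffineMap

theorem isOpen_setOf_affine_mem {I : Set ℝ} (hI : IsOpen I) (r s : ℝ) :
    IsOpen {y | r * y + s ∈ I} :=
  hI.preimage (by fun_prop : Continuous fun y : ℝ => r * y + s)

theorem ordConnected_setOf_affine_mem {I : Set ℝ} (hI : I.OrdConnected) (r s : ℝ) :
    {y | r * y + s ∈ I}.OrdConnected := by
  rcases le_total 0 r with hr | hr
  · exact hI.preimage_mono fun x y hxy => by gcongr
  · refine hI.preimage_anti fun x y hxy => ?_
    simpa using mul_le_mul_of_nonpos_left hxy hr

theorem image_affine_setOf_affine_mem {K : Type*} [Field K] {r : K} (hr : r ≠ 0) (s : K)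
    (I : Set K) : (fun y => r * y + s) '' {y | r * y + s ∈ I} = I :=
  image_preimage_eq I fun x => ⟨(x - s) / r, by field_simp; ring⟩

theorem affine_apply_affine_inv {K : Type*} [Field K] {r : K} (hr : r ≠ 0) (s x : K) :
    r * (r⁻¹ * x + -s / r) + s = x := by
  field_simp
  ring

theorem affine_inv_apply_affine {K : Type*} [Field K] {r : K} (hr : r ≠ 0) (s y : K) :
    r⁻¹ * (r * y + s) + -s / r = y := by
  field_simp
  ring

theorem comp_affine_comp_affine_inv {K : Type*} [Field K] {r : K} (hr : r ≠ 0) (s : K)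
    (q : K[X]) : (q.comp (C r * X + C s)).comp (C r⁻¹ * X + C (-s / r)) = q := by
  have h : (C r * X + C s).comp (C r⁻¹ * X + C (-s / r)) = X := by
    have hs : r * (-s / r) + s = 0 := by field_simp; ring
    simp only [add_comp, mul_comp, C_comp, X_comp, mul_add, ← mul_assoc, ← C_mul,
      mul_inv_cancel₀ hr, add_assoc, ← C_add, hs, C_1, C_0, one_mul, add_zero]
  rw [comp_assoc, h, comp_X]

theorem hasDerivAt_affine {K : Type*} [NontriviallyNormedField K] (r s y : K) :
    HasDerivAt (fun y : K => r * y + s) r y := by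
  simpa using ((hasDerivAt_id y).const_mul r).add_const s

theorem injective_affine {K : Type*} [Field K] {r : K} (hr : r ≠ 0) (s : K) :
    Function.Injective fun y : K => r * y + s := fun x y h => by
  simpa [hr] using h

theorem setIntegral_comp_affine {E : Type*} [NormedAddCommGroup E] [NormedSpace ℝ E] {I : Set ℝ}
    (hI : IsOpen I) {r : ℝ} (hr : r ≠ 0) (s : ℝ) (f : ℝ → E) :
    ∫ x in I, f x = |r| • ∫ y in {y | r * y + s ∈ I}, f (r * y + s) := by
  conv_lhs => rw [← image_affine_setOf_affine_mem hr s I]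
  rw [integral_image_eq_integral_abs_deriv_smul (isOpen_setOf_affine_mem hI r s).measurableSet
    (fun y _ => (hasDerivAt_affine r s y).hasDerivWithinAt) (injective_affine hr s).injOn,
    integral_smul]

theorem integrableOn_comp_affine {E : Type*} [NormedAddCommGroup E] [NormedSpace ℝ E] {I : Set ℝ}
    (hI : IsOpen I) {r : ℝ} (hr : r ≠ 0) (s : ℝ) {f : ℝ → E} (hf : IntegrableOn f I) :
    IntegrableOn (fun y => f (r * y + s)) {y | r * y + s ∈ I} := by
  rw [← image_affine_setOf_affine_mem hr s I, integrableOn_image_iff_integrableOn_abs_deriv_smul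
    (isOpen_setOf_affine_mem hI r s).measurableSet
    (fun y _ => (hasDerivAt_affine r s y).hasDerivWithinAt) (injective_affine hr s).injOn] at hf
  exact (integrable_smul_iff (abs_ne_zero.2 hr) _).1 hf

theorem iteratedDeriv_comp_affine {n : ℕ} {u : ℝ → ℝ} (hu : ContDiff ℝ n u) (r s y : ℝ) :
    iteratedDeriv n (fun y => u (r * y + s)) y = r ^ n * iteratedDeriv n u (r * y + s) := by
  have hmul := iteratedDeriv_comp_const_mul (n := n) (f := fun z => u (z + s))
    (hu.comp (contDiff_id.add contDiff_const)) r
  rw [iteratedDeriv_comp_add_const (n := n) (f := u) (s := s)] at hmul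
  exact congrFun hmul y

end AffineMap

/-- A space of functions that can play the role of `𝒟`: its members are regular enough for a
fourth-order operator to act on them, and it is stable under affine changes of variable. -/
structure IsTestSpace (𝒟 : Set (ℝ → ℝ)) : Prop where
  contDiff : ∀ f ∈ 𝒟, ContDiff ℝ 4 f
  comp_affine : ∀ f ∈ 𝒟, ∀ r s : ℝ, (fun y => f (r * y + s)) ∈ 𝒟

/-- The real polynomial functions, which form the smallest test space allowed. -/
def polyFunctions : Set (ℝ → ℝ) := range fun (q : ℝ[X]) (x : ℝ) => q.eval x

theorem isTestSpace_polyFunctions : IsTestSpace polyFunctions where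
  contDiff := by
    rintro _ ⟨q, rfl⟩
    exact q.contDiff_aeval 4
  comp_affine := by
    rintro _ ⟨q, rfl⟩ r s
    exact ⟨q.comp (C r * X + C s), by ext y; simp [eval_comp]⟩

theorem isTestSpace_hasTemperateGrowth :
    IsTestSpace {f : ℝ → ℝ | Function.HasTemperateGrowth f} where
  contDiff f hf := hf.1.of_le (by exact WithTop.coe_le_coe.2 le_top)
  comp_affine f hf r s := by
    have h : Function.HasTemperateGrowth fun y : ℝ => r * y + s :=
      ((Function.HasTemperateGrowth.const r).mul .id').add (.const s)
    exact Function.HasTemperateGrowth.comp hf h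

namespace DiffOp4

section ChangeOfVariable

variable {L M : DiffOp4} {I J : Set ℝ} {p q : ℝ → ℝ} {𝒟 : Set (ℝ → ℝ)} {r s κ c : ℝ}

theorem scale_one (L : DiffOp4) : L.scale 1 = L := by
  ext1 <;> simp [scale]

theorem scale_inv_scale (hκ : κ ≠ 0) (L : DiffOp4) : (L.scale κ).scale κ⁻¹ = L := by
  ext1 <;> simp [scale, ← mul_assoc, ← C_mul, hκ]

theorem affine_one_zero (L : DiffOp4) : L.affine 1 0 = L := by
  ext1 <;> simp [affine]

theorem scale_affine (κ r s : ℝ) (L : DiffOp4) :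
    (L.scale κ).affine r s = (L.affine r s).scale κ := by
  ext1 <;> simp [scale, affine] <;> ring

theorem affine_affine_inv (hr : r ≠ 0) (s : ℝ) (L : DiffOp4) :
    (L.affine r s).affine r⁻¹ (-s / r) = L := by
  have coeff_eq (k : ℕ) (q : ℝ[X]) :
      C (r⁻¹⁻¹ ^ k) * (C (r⁻¹ ^ k) * q.comp (C r * X + C s)).comp (C r⁻¹ * X + C (-s / r)) = q := by
    rw [mul_comp, C_comp, comp_affine_comp_affine_inv hr, ← mul_assoc, ← C_mul, inv_inv, inv_pow,
      mul_inv_cancel₀ (pow_ne_zero _ hr), C_1, one_mul]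
  ext1
  · simpa [affine] using coeff_eq 1 L.a₁
  · exact coeff_eq 2 L.a₂
  · exact coeff_eq 3 L.a₃
  · exact coeff_eq 4 L.a₄

theorem act_scale (κ : ℝ) (L : DiffOp4) (u : ℝ → ℝ) (x : ℝ) :
    (L.scale κ).act u x = κ * L.act u x := by
  simp only [act, scale, eval_mul, eval_C]
  ring

theorem act_affine (hr : r ≠ 0) (s : ℝ) (L : DiffOp4) {u : ℝ → ℝ} (hu : ContDiff ℝ 4 u) (y : ℝ) :
    (L.affine r s).act (fun y => u (r * y + s)) y = L.act u (r * y + s) := by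
  simp only [act, affine, ← iteratedDeriv_one]
  rw [iteratedDeriv_comp_affine (n := 4) hu,
    iteratedDeriv_comp_affine (n := 3) (hu.of_le (by norm_num)),
    iteratedDeriv_comp_affine (n := 2) (hu.of_le (by norm_num)),
    iteratedDeriv_comp_affine (n := 1) (hu.of_le (by norm_num))]
  simp only [eval_mul, eval_C, eval_comp, eval_add, eval_X]
  field_simp

theorem IsOrderFour.affine_scale (h : L.IsOrderFour) (hr : r ≠ 0) (hκ : κ ≠ 0) (s : ℝ) :
    ((L.affine r s).scale κ).IsOrderFour := by
  have hlin : (C r * X + C s : ℝ[X]).natDegree = 1 := natDegree_linear hr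
  have natDegree_le (k : ℕ) (c : ℝ) (q : ℝ[X]) (hq : q.natDegree ≤ k) :
      (C κ * (C c * q.comp (C r * X + C s))).natDegree ≤ k := by
    refine (natDegree_C_mul_le _ _).trans ((natDegree_C_mul_le _ _).trans ?_)
    rwa [natDegree_comp, hlin, mul_one]
  refine ⟨mul_ne_zero (C_ne_zero.2 hκ) (mul_ne_zero (C_ne_zero.2 (by positivity)) fun h0 => ?_),
    natDegree_le _ _ _ h.2.1, natDegree_le _ _ _ h.2.2.1, natDegree_le _ _ _ h.2.2.2.1,
    natDegree_le _ _ _ h.2.2.2.2⟩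
  exact h.1 (by rw [← comp_affine_comp_affine_inv hr s L.a₄, h0, zero_comp])

theorem IsWeight.affine_scale (h : L.IsWeight I p) (hr : r ≠ 0) (hκ : κ ≠ 0)
    (hc : 0 < c) (s : ℝ) :
    ((L.affine r s).scale κ).IsWeight {y | r * y + s ∈ I} (fun y => c * p (r * y + s)) := by
  obtain ⟨F, hF⟩ := h
  have eval_a₄ (y : ℝ) :
      ((L.affine r s).scale κ).a₄.eval y = κ * (r⁻¹ ^ 4 * L.a₄.eval (r * y + s)) := by
    simp [scale, affine, eval_comp]
  have eval_a₃ (y : ℝ) :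
      ((L.affine r s).scale κ).a₃.eval y = κ * (r⁻¹ ^ 3 * L.a₃.eval (r * y + s)) := by
    simp [scale, affine, eval_comp]
  have hpos : 0 < c * |κ| * |r⁻¹ ^ 4| := by positivity
  refine ⟨fun y => F (r * y + s) + 2 * Real.log (c * |κ| * |r⁻¹ ^ 4|), fun y hy h4 => ?_⟩
  have h4' : L.a₄.eval (r * y + s) ≠ 0 := fun h0 => h4 (by simp [eval_a₄, h0])
  obtain ⟨hderiv, hp⟩ := hF _ hy h4'
  constructor
  · refine ((hderiv.comp y (hasDerivAt_affine r s y)).add_const _).congr_deriv ?_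
    rw [eval_a₃, eval_a₄]
    field_simp
  · beta_reduce
    rw [eval_a₄, hp, abs_mul, abs_mul, add_div, mul_div_cancel_left₀ _ (two_ne_zero' ℝ),
      Real.exp_add, Real.exp_log hpos]
    have h4abs : |L.a₄.eval (r * y + s)| ≠ 0 := abs_ne_zero.2 h4'
    field_simp

theorem _root_.AdmissibleWeight.affine (h : AdmissibleWeight I p) (hI : IsOpen I) (hr : r ≠ 0)
    (s c : ℝ) : AdmissibleWeight {y | r * y + s ∈ I} (fun y => c * p (r * y + s)) := fun q => by
  refine IntegrableOn.congr_fun ((integrableOn_comp_affine hI hr s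
    (h (q.comp (C r⁻¹ * X + C (-s / r))))).const_mul c) (fun y _ => ?_)
    (isOpen_setOf_affine_mem hI r s).measurableSet
  simp only [eval_comp, eval_add, eval_mul, eval_C, eval_X, affine_inv_apply_affine hr]
  ring

theorem SymmetricOn.affine_scale (h : L.SymmetricOn 𝒟 I p) (h𝒟 : IsTestSpace 𝒟) (hI : IsOpen I)
    (hr : r ≠ 0) (s κ c : ℝ) :
    ((L.affine r s).scale κ).SymmetricOn 𝒟 {y | r * y + s ∈ I} (fun y => c * p (r * y + s)) := by
  have exists_comp_affine (u : ℝ → ℝ) (hu : u ∈ 𝒟) : ∃ u' ∈ 𝒟, u = fun y => u' (r * y + s) :=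
    ⟨_, h𝒟.comp_affine u hu r⁻¹ (-s / r), by simp only [affine_inv_apply_affine hr]⟩
  intro u hu v hv
  obtain ⟨u, hu', rfl⟩ := exists_comp_affine u hu
  obtain ⟨v, hv', rfl⟩ := exists_comp_affine v hv
  have hsymm := h u hu' v hv'
  rw [setIntegral_comp_affine hI hr s, setIntegral_comp_affine hI hr s] at hsymm
  calc ∫ y in {y | r * y + s ∈ I}, c * p (r * y + s) *
        ((L.affine r s).scale κ).act (fun y => u (r * y + s)) y * v (r * y + s)
      = (c * κ) * ∫ y in {y | r * y + s ∈ I},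
          p (r * y + s) * L.act u (r * y + s) * v (r * y + s) := by
        rw [← integral_const_mul]
        congr 1 with y
        rw [act_scale, act_affine hr s L (h𝒟.contDiff u hu')]
        ring
    _ = (c * κ) * ∫ y in {y | r * y + s ∈ I},
          p (r * y + s) * u (r * y + s) * L.act v (r * y + s) := by
        rw [smul_right_injective ℝ (abs_ne_zero.2 hr) hsymm]
    _ = _ := by
        rw [← integral_const_mul]
        congr 1 with y
        rw [act_scale, act_affine hr s L (h𝒟.contDiff v hv')]
        ring

theorem SelfAdjointWith.affine_scale (H : L.SelfAdjointWith 𝒟 I p) (h𝒟 : IsTestSpace 𝒟)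
    (hr : r ≠ 0) (hκ : κ ≠ 0) (hc : 0 < c) (s : ℝ) :
    ((L.affine r s).scale κ).SelfAdjointWith 𝒟 {y | r * y + s ∈ I}
      (fun y => c * p (r * y + s)) where
  order_four := H.order_four.affine_scale hr hκ s
  isOpen := isOpen_setOf_affine_mem H.isOpen r s
  ordConnected := ordConnected_setOf_affine_mem H.ordConnected r s
  nonempty := by
    obtain ⟨x, hx⟩ := H.nonempty
    exact ⟨r⁻¹ * x + -s / r, by rwa [mem_ofPred_eq, affine_apply_affine_inv hr]⟩
  weight := H.weight.affine_scale hr hκ hc s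
  admissible := H.admissible.affine H.isOpen hr s c
  symmetric := H.symmetric.affine_scale h𝒟 H.isOpen hr s κ c

theorem SelfAdjointWith.mono {𝒟' : Set (ℝ → ℝ)} (H : L.SelfAdjointWith 𝒟 I p) (h : 𝒟' ⊆ 𝒟) :
    L.SelfAdjointWith 𝒟' I p :=
  { H with symmetric := fun u hu v hv => H.symmetric u (h hu) v (h hv) }

theorem SelfAdjointWith.congr (H : L.SelfAdjointWith 𝒟 I p) (h : ∀ x ∈ I, q x = p x) :
    L.SelfAdjointWith 𝒟 I q :=
  { H with
    weight := by
      obtain ⟨F, hF⟩ := H.weight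
      exact ⟨F, fun x hx h4 => ⟨(hF x hx h4).1, (h x hx).trans (hF x hx h4).2⟩⟩
    admissible := fun g => (H.admissible g).congr_fun (fun x hx => by simp only [h x hx])
      H.isOpen.measurableSet
    symmetric := fun u hu v hv => by
      refine Eq.trans ?_ ((H.symmetric u hu v hv).trans ?_) <;>
        exact setIntegral_congr_fun H.isOpen.measurableSet fun x hx => by simp only [h x hx] }

theorem SelfAdjointWith.of_affine_scale (H : M.SelfAdjointWith 𝒟 J q) (h𝒟 : IsTestSpace 𝒟)
    (hr : r ≠ 0) (hκ : κ ≠ 0) (hc : 0 < c) (hM : (L.affine r s).scale κ = M)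
    (hJ : {y | r * y + s ∈ I} = J) (hp : ∀ y ∈ J, p (r * y + s) = c * q y) :
    L.SelfAdjointWith 𝒟 I p := by
  have h := H.affine_scale h𝒟 (inv_ne_zero hr) (inv_ne_zero hκ) hc (-s / r)
  have hI : {x | r⁻¹ * x + -s / r ∈ J} = I := by
    ext x
    simp only [← hJ, mem_ofPred_eq, affine_apply_affine_inv hr]
  rw [← hM, scale_affine, scale_inv_scale hκ, affine_affine_inv hr, hI] at h
  refine h.congr fun x hx => ?_
  rw [← hI] at hx
  rw [← hp _ hx, affine_apply_affine_inv hr]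

end ChangeOfVariable

end DiffOp4

section PolynomialLemmas

theorem derivative_surjective {K : Type*} [Field K] [CharZero K] :
    Function.Surjective (derivative : K[X] → K[X]) := fun w => by
  induction w using Polynomial.induction_on' with
  | add p q hp hq =>
    obtain ⟨v, rfl⟩ := hp
    obtain ⟨w, rfl⟩ := hq
    exact ⟨v + w, derivative_add⟩
  | monomial n a =>
    have hn : (n : K) + 1 ≠ 0 := n.cast_add_one_ne_zero
    exact ⟨monomial (n + 1) (a / (n + 1)), by simp [hn]⟩

theorem ae_eval_ne_zero {q : ℝ[X]} (hq : q ≠ 0) : ∀ᵐ x : ℝ, q.eval x ≠ 0 :=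
  measure_eq_zero_iff_ae_notMem.1 ((q.finite_setOfPred_isRoot hq).measure_zero volume)

theorem iteratedDeriv_eval {𝕜 : Type*} [NontriviallyNormedField 𝕜] (k : ℕ) (u : 𝕜[X]) :
    iteratedDeriv k (fun x => u.eval x) = fun x => (derivative^[k] u).eval x := by
  induction k generalizing u with
  | zero => simp
  | succ k ih =>
    have hderiv : deriv (fun x => u.eval x) = fun x => (derivative u).eval x := by
      ext x; exact u.deriv
    rw [iteratedDeriv_succ', hderiv, ih, Function.iterate_succ_apply]

section Semiring

variable {R : Type*} [CommSemiring R] {a u : R[X]} {k n : ℕ}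

theorem natDegree_mul_iterate_derivative_le (ha : a.natDegree ≤ k) (hu : u.natDegree ≤ n) :
    (a * derivative^[k] u).natDegree ≤ n := by
  rcases lt_or_ge n k with h | h
  · simp [iterate_derivative_eq_zero (hu.trans_lt h)]
  · exact (natDegree_mul_le_of_le ha (natDegree_iterate_derivative u k)).trans (by omega)

theorem coeff_mul_iterate_derivative (ha : a.natDegree ≤ k) (hu : u.natDegree ≤ n) :
    (a * derivative^[k] u).coeff n = a.coeff k * n.descFactorial k * u.coeff n := by
  rcases lt_or_ge n k with h | h
  · simp [iterate_derivative_eq_zero (hu.trans_lt h), Nat.descFactorial_eq_zero_iff_lt.2 h]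
  · obtain ⟨m, rfl⟩ := Nat.exists_eq_add_of_le h
    rw [coeff_mul_add_eq_of_natDegree_le ha
      ((natDegree_iterate_derivative u k).trans (by omega)), coeff_iterate_derivative,
      add_comm m k, nsmul_eq_mul, mul_assoc]

end Semiring

section Ring

variable {R : Type*} [CommRing R] {f g : R[X]} {k : ℕ}

theorem natDegree_sub_C_mul_derivative_le (c : R) (hf : f.natDegree ≤ k) (hg : g.natDegree ≤ k) :
    (f - C c * derivative g).natDegree ≤ k := by
  refine (natDegree_sub_le_of_le hf ?_).trans (max_self k).le
  exact (natDegree_C_mul_le _ _).trans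
    ((natDegree_derivative_le g).trans ((Nat.sub_le _ _).trans hg))

theorem coeff_sub_C_mul_derivative (f : R[X]) (c : R) (hg : g.natDegree ≤ k) :
    (f - C c * derivative g).coeff k = f.coeff k := by
  rw [coeff_sub, coeff_C_mul, coeff_derivative,
    coeff_eq_zero_of_natDegree_lt (Nat.lt_succ_of_le hg),
    zero_mul, mul_zero, sub_zero]

end Ring

section Orthogonal

variable {K : Type*} [Field K] {φ : K[X] →ₗ[K] K}

theorem map_mul_eq_zero_of_degree_lt {y v : K[X]} {n : ℕ}
    (hX : ∀ i < n, φ (y * X ^ i) = 0) (hv : v.degree < n) : φ (y * v) = 0 := by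
  rcases eq_or_ne v 0 with rfl | hv0
  · simp
  rw [v.as_sum_range' n ((natDegree_lt_iff_degree_lt hv0).2 hv), Finset.mul_sum, map_sum]
  refine Finset.sum_eq_zero fun i hi => ?_
  rw [← smul_X_eq_monomial, mul_smul_comm, map_smul, hX i (Finset.mem_range.1 hi), smul_zero]

theorem exists_orthogonal_polynomial (hφ : ∀ q, φ (q * q) = 0 → q = 0) (n : ℕ) :
    ∃ y : K[X], y ≠ 0 ∧ y.natDegree = n ∧ ∀ v : K[X], v.degree < n → φ (y * v) = 0 := by
  let Φ : degreeLT K (n + 1) →ₗ[K] (Fin n → K) := LinearMap.pi fun i =>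
    φ ∘ₗ (LinearMap.mulRight K (X ^ (i : ℕ))) ∘ₗ (degreeLT K (n + 1)).subtype
  have : FiniteDimensional K (degreeLT K (n + 1)) :=
    Module.Finite.equiv (degreeLTEquiv K (n + 1)).symm
  have hker : LinearMap.ker Φ ≠ ⊥ := by
    apply LinearMap.ker_ne_bot_of_finrank_lt
    rw [(degreeLTEquiv K (n + 1)).finrank_eq]
    simp
  obtain ⟨⟨y, hy⟩, hyΦ, hy_ne⟩ := (Submodule.ne_bot_iff _).1 hker
  have hy0 : y ≠ 0 := fun h => hy_ne (Subtype.ext h)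
  have horth (v : K[X]) (hv : v.degree < n) : φ (y * v) = 0 :=
    map_mul_eq_zero_of_degree_lt (fun i hi => congrFun (LinearMap.mem_ker.1 hyΦ) ⟨i, hi⟩) hv
  refine ⟨y, hy0, natDegree_eq_of_degree_eq_some (le_antisymm ?_ ?_), horth⟩
  · exact Order.le_of_lt_succ (mem_degreeLT.1 hy)
  · by_contra! hlt
    exact hy0 (hφ y (horth y hlt))

theorem exists_eigenpolynomial (hφ : ∀ q, φ (q * q) = 0 → q = 0) {T : K[X] → K[X]} {lam : ℕ → K}
    (hdeg : ∀ u, (T u).degree ≤ u.degree)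
    (hlead : ∀ u, (T u).coeff u.natDegree = lam u.natDegree * u.leadingCoeff)
    (hsymm : ∀ u v, φ (T u * v) = φ (u * T v)) (n : ℕ) :
    ∃ y : K[X], y ≠ 0 ∧ y.natDegree = n ∧ T y = C (lam n) * y := by
  obtain ⟨y, hy0, rfl, horth⟩ := exists_orthogonal_polynomial hφ n
  refine ⟨y, hy0, rfl, sub_eq_zero.1 ?_⟩
  set z := T y - C (lam y.natDegree) * y with hz
  have hz_deg : z.degree < y.natDegree := by
    rw [degree_lt_iff_coeff_zero]
    intro m hm
    rw [hz, coeff_sub, coeff_C_mul]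
    rcases hm.eq_or_lt with rfl | hm
    · rw [hlead, coeff_natDegree, sub_self]
    · have hy_deg : y.degree < m := degree_le_natDegree.trans_lt (by exact_mod_cast hm)
      rw [coeff_eq_zero_of_degree_lt ((hdeg y).trans_lt hy_deg),
        coeff_eq_zero_of_degree_lt hy_deg, mul_zero, sub_zero]
  -- `z` is a combination of `T y` and `y`, both orthogonal to every polynomial of lower degree.
  apply hφ
  calc φ (z * z) = φ (y * T z) - lam y.natDegree * φ (y * z) := by
        rw [← hsymm, ← smul_eq_mul (lam _), ← map_smul, ← map_sub, smul_eq_C_mul, ← mul_assoc,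
          ← sub_mul]
    _ = 0 := by rw [horth _ ((hdeg z).trans_lt hz_deg), horth _ hz_deg, mul_zero, sub_zero]

end Orthogonal

end PolynomialLemmas

namespace AdmissibleWeight

variable {I : Set ℝ} {p : ℝ → ℝ}

/-- The moment functional `q ↦ ∫_I p q` on polynomials of an admissible weight. -/
def moment (h : AdmissibleWeight I p) : ℝ[X] →ₗ[ℝ] ℝ where
  toFun q := ∫ x in I, p x * q.eval x
  map_add' q r := by
    rw [← integral_add (h q) (h r)]
    simp only [eval_add, mul_add]
  map_smul' c q := by
    rw [RingHom.id_apply, smul_eq_mul, ← integral_const_mul]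
    simp only [eval_smul, smul_eq_mul, mul_left_comm]

theorem moment_apply (h : AdmissibleWeight I p) (q : ℝ[X]) :
    h.moment q = ∫ x in I, p x * q.eval x := rfl

theorem moment_C_mul (h : AdmissibleWeight I p) (c : ℝ) (q : ℝ[X]) :
    h.moment (C c * q) = c * h.moment q := by
  rw [← smul_eq_C_mul, map_smul, smul_eq_mul]

theorem eq_zero_of_moment_mul_self (h : AdmissibleWeight I p) (hI : volume I ≠ 0)
    (hp : ∀ᵐ x ∂volume.restrict I, 0 < p x) {q : ℝ[X]} (hq : h.moment (q * q) = 0) : q = 0 := by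
  by_contra hq0
  have hpos : ∀ᵐ x ∂volume.restrict I, 0 < p x * (q * q).eval x := by
    filter_upwards [hp, ae_restrict_of_ae (ae_eval_ne_zero hq0)] with x hpx hqx
    rw [eval_mul]
    exact mul_pos hpx (mul_self_pos.2 hqx)
  rw [moment_apply, integral_eq_zero_iff_of_nonneg_ae (hpos.mono fun _ => le_of_lt) (h _)] at hq
  refine hI (Measure.restrict_eq_zero.1 (ae_eq_bot.1 (eventually_false_iff_eq_bot.1 ?_)))
  filter_upwards [hpos, hq] with x hx hx0 using hx.ne' hx0

end AdmissibleWeight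

namespace DiffOp4

variable {L : DiffOp4} {I : Set ℝ} {p : ℝ → ℝ}

/-- The action of the operator on polynomials. -/
def polyAct (L : DiffOp4) (u : ℝ[X]) : ℝ[X] :=
  L.a₄ * derivative^[4] u + L.a₃ * derivative^[3] u + L.a₂ * derivative^[2] u
    + L.a₁ * derivative^[1] u

theorem act_eval (L : DiffOp4) (u : ℝ[X]) (x : ℝ) :
    L.act (fun x => u.eval x) x = (L.polyAct u).eval x := by
  simp only [act, polyAct, iteratedDeriv_eval, eval_add, eval_mul, Polynomial.deriv,
    Function.iterate_one]

theorem IsWeight.pos (h : L.IsWeight I p) {x : ℝ} (hx : x ∈ I) (h4 : L.a₄.eval x ≠ 0) :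
    0 < p x := by
  obtain ⟨F, hF⟩ := h
  rw [(hF x hx h4).2]
  positivity

theorem IsWeight.ae_pos (h : L.IsWeight I p) (hI : MeasurableSet I) (h4 : L.a₄ ≠ 0) :
    ∀ᵐ x ∂volume.restrict I, 0 < p x := by
  filter_upwards [ae_restrict_of_ae (ae_eval_ne_zero h4), ae_restrict_mem hI] with x hx4 hx
  exact h.pos hx hx4

section FormalSymmetry

/-- Twice the numerator of the logarithmic derivative `p' / p` of the weight over `a₄`. -/
def logDerivNum (L : DiffOp4) : ℝ[X] := L.a₃ - 2 * derivative L.a₄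

/-- Four times the numerator over `a₄` of `g`, where `p g` is the coefficient of the term of
order two of the operator in the symmetric form `(p a₄ u'')'' + (p g u')'`. -/
def secondNum (L : DiffOp4) : ℝ[X] :=
  4 * L.a₄ * L.a₂ - 2 * L.a₄ * derivative L.a₃ - L.logDerivNum * L.a₃

/-- The identity `p a₁ = (p g)'` between coefficients, freed from denominators. Together with the
definitions of `p` and `g` it says that `p L u = (p a₄ u'')'' + (p g u')'`. -/
def IsFormallySymmetric (L : DiffOp4) : Prop :=
  8 * L.a₄ ^ 2 * L.a₁ = (L.logDerivNum - 2 * derivative L.a₄) * L.secondNum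
    + 2 * derivative L.secondNum * L.a₄

namespace SelfAdjointWith

variable (H : L.SelfAdjointWith polyFunctions I p)
include H

theorem eq_zero_of_moment_mul_self {q : ℝ[X]} (h : H.admissible.moment (q * q) = 0) : q = 0 :=
  H.admissible.eq_zero_of_moment_mul_self (H.isOpen.measure_pos volume H.nonempty).ne'
    (H.weight.ae_pos H.isOpen.measurableSet H.order_four.1) h

theorem moment_polyAct_mul (u v : ℝ[X]) :
    H.admissible.moment (L.polyAct u * v) = H.admissible.moment (u * L.polyAct v) := by
  have := H.symmetric _ ⟨u, rfl⟩ _ ⟨v, rfl⟩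
  simp only [act_eval] at this
  simpa only [AdmissibleWeight.moment_apply, eval_mul, mul_assoc] using this

theorem moment_pearson (q : ℝ[X]) :
    H.admissible.moment (2 * L.a₄ * derivative q + L.a₃ * q) = 0 := by
  -- The triple commutator `[[[L, x], x], x]` is `24 a₄ D + 6 a₃`, minus its value at `1`.
  have hcomm : C 12 * (2 * L.a₄ * derivative q + L.a₃ * q) =
      (L.polyAct (X ^ 3 * q) * 1 - X ^ 3 * q * L.polyAct 1)
      - C 3 * (L.polyAct (X ^ 2 * q) * X - X ^ 2 * q * L.polyAct X)
      + C 3 * (L.polyAct (X * q) * X ^ 2 - X * q * L.polyAct (X ^ 2))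
      - (L.polyAct q * X ^ 3 - q * L.polyAct (X ^ 3)) := by
    simp only [polyAct, Function.iterate_succ, Function.iterate_zero, Function.comp, id,
      derivative_mul, derivative_X, derivative_X_pow, derivative_one, derivative_add,
      map_ofNat, derivative_C, derivative_zero, Nat.cast_ofNat, derivative_ofNat]
    norm_num
    rw [show (C 2 : ℝ[X]) = 2 from map_ofNat C 2]
    ring
  have hmoment := congrArg H.admissible.moment hcomm
  simp only [map_add, map_sub, AdmissibleWeight.moment_C_mul, H.moment_polyAct_mul, sub_self,
    mul_zero, add_zero] at hmoment
  rw [map_add]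
  linarith

theorem moment_symmetry (w : ℝ[X]) :
    H.admissible.moment (L.a₃ * derivative (derivative w) + 2 * L.a₂ * derivative w
      + 2 * L.a₁ * w) = 0 := by
  obtain ⟨v, rfl⟩ := derivative_surjective w
  have hL1 : L.polyAct 1 = 0 := by simp [polyAct]
  have hLv : H.admissible.moment (L.polyAct v) = 0 := by
    simpa [hL1] using H.moment_polyAct_mul v 1
  have hpearson := H.moment_pearson (derivative (derivative (derivative v)))
  have hsum : L.a₃ * derivative (derivative (derivative v)) + 2 * L.a₂ * derivative (derivative v)
      + 2 * L.a₁ * derivative v = C 2 * L.polyAct v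
        - (2 * L.a₄ * derivative (derivative (derivative (derivative v)))
          + L.a₃ * derivative (derivative (derivative v))) := by
    simp only [polyAct, Function.iterate_succ, Function.iterate_zero, Function.comp, id, map_ofNat]
    ring
  rw [hsum, map_sub, AdmissibleWeight.moment_C_mul, hLv, hpearson, mul_zero, sub_zero]

theorem isFormallySymmetric : L.IsFormallySymmetric := by
  rw [IsFormallySymmetric, ← sub_eq_zero]
  set d := 8 * L.a₄ ^ 2 * L.a₁ - ((L.logDerivNum - 2 * derivative L.a₄) * L.secondNum
    + 2 * derivative L.secondNum * L.a₄) with hd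
  have hsymm := H.moment_symmetry (L.a₄ ^ 2 * d)
  have hpearson := H.moment_pearson
    (2 * L.a₃ * (L.a₄ * derivative d + 2 * derivative L.a₄ * d) + L.secondNum * d)
  refine H.eq_zero_of_moment_mul_self ?_
  have hdd : d * d =
      C 4 * (L.a₃ * derivative (derivative (L.a₄ ^ 2 * d)) + 2 * L.a₂ * derivative (L.a₄ ^ 2 * d)
        + 2 * L.a₁ * (L.a₄ ^ 2 * d))
      - (2 * L.a₄ * derivative (2 * L.a₃ * (L.a₄ * derivative d + 2 * derivative L.a₄ * d)
          + L.secondNum * d)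
        + L.a₃ * (2 * L.a₃ * (L.a₄ * derivative d + 2 * derivative L.a₄ * d)
          + L.secondNum * d)) := by
    nth_rewrite 1 [hd]
    simp only [secondNum, logDerivNum, derivative_mul, derivative_add, derivative_sub,
      derivative_ofNat, map_ofNat, pow_two]
    ring
  rw [hdd, map_sub, AdmissibleWeight.moment_C_mul, hsymm, hpearson, mul_zero, sub_zero]

end SelfAdjointWith

section Degree

variable {d k : ℕ}

theorem logDerivNum_eq (L : DiffOp4) : L.logDerivNum = L.a₃ - C 2 * derivative L.a₄ := by
  rw [logDerivNum, map_ofNat]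

theorem natDegree_secondNum_le (h2 : L.a₂.natDegree ≤ 2) (h3 : L.a₃.natDegree ≤ k)
    (h4 : L.a₄.natDegree ≤ d) (hdk : d ≤ k) (hd : d + 2 ≤ 2 * k) :
    L.secondNum.natDegree ≤ k + k := by
  have hlog : L.logDerivNum.natDegree ≤ k :=
    L.logDerivNum_eq ▸ natDegree_sub_C_mul_derivative_le 2 h3 (h4.trans hdk)
  have h42 := natDegree_mul_le_of_le
    (natDegree_mul_le_of_le (natDegree_ofNat (R := ℝ) 4).le h4) h2
  have h43 := natDegree_mul_le_of_le (natDegree_mul_le_of_le (natDegree_ofNat (R := ℝ) 2).le h4)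
    ((natDegree_derivative_le L.a₃).trans (Nat.sub_le_sub_right h3 1))
  refine natDegree_sub_le_of_le (natDegree_sub_le_of_le h42 h43)
    (natDegree_mul_le_of_le hlog h3) |>.trans ?_
  omega

theorem coeff_secondNum (h2 : L.a₂.natDegree ≤ 2) (h3 : L.a₃.natDegree ≤ k)
    (h4 : L.a₄.natDegree ≤ d) (hdk : d ≤ k) (hd : d + 2 < 2 * k) :
    L.secondNum.coeff (k + k) = -(L.a₃.coeff k * L.a₃.coeff k) := by
  have hlog : L.logDerivNum.natDegree ≤ k :=
    L.logDerivNum_eq ▸ natDegree_sub_C_mul_derivative_le 2 h3 (h4.trans hdk)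
  have h42 := natDegree_mul_le_of_le
    (natDegree_mul_le_of_le (natDegree_ofNat (R := ℝ) 4).le h4) h2
  have h43 := natDegree_mul_le_of_le (natDegree_mul_le_of_le (natDegree_ofNat (R := ℝ) 2).le h4)
    ((natDegree_derivative_le L.a₃).trans (Nat.sub_le_sub_right h3 1))
  rw [secondNum, coeff_sub,
    coeff_eq_zero_of_natDegree_lt ((natDegree_sub_le_of_le h42 h43).trans_lt (by omega)),
    coeff_mul_add_eq_of_natDegree_le hlog h3, logDerivNum_eq,
    coeff_sub_C_mul_derivative _ _ (h4.trans hdk), zero_sub]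

theorem IsFormallySymmetric.natDegree_le (h : L.IsFormallySymmetric) (hL : L.IsOrderFour)
    (h3 : L.a₃ ≠ 0) (hd : L.a₄.natDegree ≤ L.a₃.natDegree) :
    3 * L.a₃.natDegree ≤ 2 * L.a₄.natDegree + 1 ∨ 2 * L.a₃.natDegree ≤ L.a₄.natDegree + 2 := by
  set d := L.a₄.natDegree with hd4
  set k := L.a₃.natDegree with hk3
  by_contra! hcon
  have hs := natDegree_secondNum_le hL.2.2.1 hk3.ge hd4.ge hd hcon.2.le
  have hlog4 : L.logDerivNum - 2 * derivative L.a₄ = L.a₃ - C 4 * derivative L.a₄ := by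
    rw [logDerivNum, map_ofNat]
    ring
  have hlhs : (8 * L.a₄ ^ 2 * L.a₁).coeff (k + (k + k)) = 0 := by
    have hdeg := natDegree_mul_le_of_le (natDegree_mul_le_of_le (natDegree_ofNat (R := ℝ) 8).le
      (natDegree_pow_le_of_le 2 hd4.ge)) hL.2.1
    exact coeff_eq_zero_of_natDegree_lt (hdeg.trans_lt (by omega))
  have hrhs : (2 * derivative L.secondNum * L.a₄).coeff (k + (k + k)) = 0 := by
    have hdeg := natDegree_mul_le_of_le (natDegree_mul_le_of_le (natDegree_ofNat (R := ℝ) 2).le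
      (natDegree_derivative_le L.secondNum)) hd4.ge
    exact coeff_eq_zero_of_natDegree_lt (hdeg.trans_lt (by omega))
  have hcube := congrArg (coeff · (k + (k + k))) h
  simp only [coeff_add] at hcube
  rw [hlhs, hrhs, hlog4, coeff_mul_add_eq_of_natDegree_le
    (natDegree_sub_C_mul_derivative_le 4 hk3.ge (hd4.ge.trans hd)) hs,
    coeff_sub_C_mul_derivative _ _ (hd4.ge.trans hd),
    coeff_secondNum hL.2.2.1 hk3.ge hd4.ge hd hcon.2] at hcube
  have hlead : L.a₃.coeff k ^ 3 = 0 := by linarith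
  exact h3 (leadingCoeff_eq_zero.1 (pow_eq_zero_iff three_ne_zero |>.1 hlead))

end Degree

end FormalSymmetry

section Eigenvalues

/-- The coefficient of `xⁿ` in `L xⁿ`. -/
def diagonal (L : DiffOp4) (n : ℕ) : ℝ :=
  L.a₄.coeff 4 * n.descFactorial 4 + L.a₃.coeff 3 * n.descFactorial 3
    + L.a₂.coeff 2 * n.descFactorial 2 + L.a₁.coeff 1 * n.descFactorial 1

theorem diagonal_eq (L : DiffOp4) (n : ℕ) :
    L.diagonal n = L.a₄.coeff 4 * (n * (n - 1) * (n - 2) * (n - 3))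
      + L.a₃.coeff 3 * (n * (n - 1) * (n - 2)) + L.a₂.coeff 2 * (n * (n - 1))
      + L.a₁.coeff 1 * n := by
  simp only [diagonal, ← descPochhammer_eval_eq_descFactorial ℝ, descPochhammer_succ_eval,
    descPochhammer_zero, eval_one]
  push_cast
  ring

theorem degree_polyAct_le (hL : L.IsOrderFour) (u : ℝ[X]) : (L.polyAct u).degree ≤ u.degree := by
  rcases eq_or_ne u 0 with rfl | hu
  · simp [polyAct]
  rw [degree_eq_natDegree hu]
  exact degree_le_of_natDegree_le (natDegree_add_le_of_degree_le (natDegree_add_le_of_degree_le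
    (natDegree_add_le_of_degree_le (natDegree_mul_iterate_derivative_le hL.2.2.2.2 le_rfl)
      (natDegree_mul_iterate_derivative_le hL.2.2.2.1 le_rfl))
    (natDegree_mul_iterate_derivative_le hL.2.2.1 le_rfl))
    (natDegree_mul_iterate_derivative_le hL.2.1 le_rfl))

theorem coeff_natDegree_polyAct (hL : L.IsOrderFour) (u : ℝ[X]) :
    (L.polyAct u).coeff u.natDegree = L.diagonal u.natDegree * u.leadingCoeff := by
  simp only [polyAct, coeff_add, coeff_mul_iterate_derivative hL.2.2.2.2 le_rfl,
    coeff_mul_iterate_derivative hL.2.2.2.1 le_rfl, coeff_mul_iterate_derivative hL.2.2.1 le_rfl,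
    coeff_mul_iterate_derivative hL.2.1 le_rfl, diagonal, coeff_natDegree]
  ring

theorem SelfAdjointWith.hasEigenvalues (H : L.SelfAdjointWith polyFunctions I p) :
    L.HasEigenvalues L.diagonal := by
  constructor
  · intro n
    obtain ⟨y, hy0, hyn, hy⟩ := exists_eigenpolynomial (fun _ => H.eq_zero_of_moment_mul_self)
      (degree_polyAct_le H.order_four) (coeff_natDegree_polyAct H.order_four)
      H.moment_polyAct_mul n
    exact ⟨y, hy0, hyn, fun x => by rw [act_eval, hy, eval_mul, eval_C]⟩
  · intro y μ hy0 hy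
    have hLy : L.polyAct y = C μ * y := Polynomial.funext fun x => by
      rw [← act_eval, hy, eval_mul, eval_C]
    have hcoeff := coeff_natDegree_polyAct H.order_four y
    rw [hLy, coeff_C_mul, coeff_natDegree] at hcoeff
    exact mul_right_cancel₀ (leadingCoeff_ne_zero.2 hy0) hcoeff

end Eigenvalues

end DiffOp4

theorem eventually_eval_ne_zero {q : ℝ[X]} (hq : q ≠ 0) (t : ℝ) :
    ∀ᶠ x in 𝓝[≠] t, q.eval x ≠ 0 :=
  nhdsNE_le_cofinite t (q.finite_setOfPred_isRoot hq).compl_mem_cofinite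

theorem tendsto_eval (q : ℝ[X]) {t : ℝ} {l : Filter ℝ} (h : l ≤ 𝓝 t) :
    Tendsto (fun x => q.eval x) l (𝓝 (q.eval t)) :=
  (q.continuous.tendsto t).mono_left h

theorem tendsto_eval_div (f g : ℝ[X]) {t : ℝ} {l : Filter ℝ} (h : l ≤ 𝓝 t) (hg : g.eval t ≠ 0) :
    Tendsto (fun x => f.eval x / g.eval x) l (𝓝 (f.eval t / g.eval t)) :=
  (tendsto_eval f h).div (tendsto_eval g h) hg

section LogDeriv

variable {f φ : ℝ → ℝ} {u w : ℝ[X]}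

theorem exists_pos_le_of_abs_logDeriv_le {δ K : ℝ} (hδ : 0 < δ)
    (hpos : ∀ x ∈ Ioo 0 δ, 0 < f x) (hd : ∀ x ∈ Ioo 0 δ, HasDerivAt f (f x * φ x) x)
    (hb : ∀ x ∈ Ioo 0 δ, |φ x| ≤ K) : ∃ c > 0, ∀ x ∈ Ioo 0 δ, c ≤ f x := by
  have hmid : δ / 2 ∈ Ioo 0 δ := ⟨half_pos hδ, half_lt_self hδ⟩
  have hK : 0 ≤ K := (abs_nonneg _).trans (hb _ hmid)
  have hlog : ∀ x ∈ Ioo 0 δ, HasDerivWithinAt (fun x => Real.log (f x)) (φ x) (Ioo 0 δ) x := by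
    intro x hx
    have := ((hd x hx).log (hpos x hx).ne').hasDerivWithinAt (s := Ioo 0 δ)
    rwa [mul_div_cancel_left₀ _ (hpos x hx).ne'] at this
  refine ⟨Real.exp (Real.log (f (δ / 2)) - K * δ), Real.exp_pos _, fun x hx => ?_⟩
  rw [← Real.le_log_iff_exp_le (hpos x hx)]
  have hmvt : |Real.log (f (δ / 2)) - Real.log (f x)| ≤ K * |δ / 2 - x| :=
    (convex_Ioo 0 δ).norm_image_sub_le_of_norm_hasDerivWithin_le hlog hb hx hmid
  have hdist : |δ / 2 - x| ≤ δ := abs_le.2 ⟨by linarith [hx.2], by linarith [hx.1]⟩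
  linarith [(le_abs_self _).trans (hmvt.trans (mul_le_mul_of_nonneg_left hdist hK))]

theorem exists_pos_le_of_logDeriv_eq_div (hw : w.eval 0 ≠ 0)
    (h : ∀ᶠ x in 𝓝[>] (0 : ℝ), 0 < f x ∧ HasDerivAt f (f x * (u.eval x / w.eval x)) x) :
    ∃ c > 0, ∀ᶠ x in 𝓝[>] (0 : ℝ), c ≤ f x := by
  have hlim := tendsto_eval_div u w (l := 𝓝[>] 0) nhdsWithin_le_nhds hw
  have hb := hlim.abs.eventually_le_const (lt_add_one _)
  obtain ⟨δ, hδ, hsub⟩ := mem_nhdsGT_iff_exists_Ioo_subset.1 (h.and hb)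
  obtain ⟨c, hc, hcf⟩ := exists_pos_le_of_abs_logDeriv_le hδ (fun x hx => (hsub hx).1.1)
    (fun x hx => (hsub hx).1.2) (fun x hx => (hsub hx).2)
  exact ⟨c, hc, mem_of_superset (Ioo_mem_nhdsGT hδ) hcf⟩

theorem eval_eq_zero_of_tendsto_mul_div {g : ℝ → ℝ} {c : ℝ} (hw : w.eval 0 ≠ 0) (hc : 0 < c)
    (hg : ∀ᶠ x in 𝓝[>] (0 : ℝ), c ≤ g x)
    (h : Tendsto (fun x => g x * (u.eval x / w.eval x)) (𝓝[>] 0) (𝓝 0)) : u.eval 0 = 0 := by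
  have hlim := tendsto_eval_div u w (l := 𝓝[>] 0) nhdsWithin_le_nhds hw
  have hzero : Tendsto (fun x => u.eval x / w.eval x) (𝓝[>] 0) (𝓝 0) := by
    have hbound := h.abs.const_mul c⁻¹
    rw [abs_zero, mul_zero] at hbound
    refine squeeze_zero_norm' (hg.mono fun x hx => ?_) hbound
    rw [abs_mul, abs_of_pos (hc.trans_le hx), ← mul_assoc, Real.norm_eq_abs]
    exact le_mul_of_one_le_left (abs_nonneg _) ((le_inv_mul_iff₀ hc).2 (by rwa [mul_one]))
  exact (div_eq_zero_iff.1 (tendsto_nhds_unique hlim hzero)).resolve_right hw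

end LogDeriv

section FundamentalTheorem

variable {E : Type*} [NormedAddCommGroup E] [NormedSpace ℝ E] [CompleteSpace E] {I s : Set ℝ}
  {G g : ℝ → E}

theorem norm_sub_le_setIntegral_norm (hI : I.OrdConnected) (hint : IntegrableOn g I) {x y : ℝ}
    (hx : x ∈ I) (hy : y ∈ I) (hd : ∀ z ∈ uIcc x y, HasDerivAt G (g z) z) :
    ‖G y - G x‖ ≤ ∫ z in I, ‖g z‖ := by
  have hsub : uIcc x y ⊆ I := hI.uIcc_subset hx hy
  rw [← intervalIntegral.integral_eq_sub_of_hasDerivAt hd (hint.mono_set hsub).intervalIntegrable]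
  refine intervalIntegral.norm_integral_le_integral_norm_uIoc.trans
    (setIntegral_mono_set hint.norm (ae_of_all _ fun z => norm_nonneg _) ?_)
  exact (uIoc_subset_uIcc.trans hsub).eventuallyLE

theorem tendsto_sub_setIntegral {ι : Type*} {l : Filter ι} [l.IsCountablyGenerated] {a b : ι → ℝ}
    (hI : I.OrdConnected) (hs : s.Countable) (hcont : ContinuousOn G I)
    (hd : ∀ x ∈ I \ s, HasDerivAt G (g x) x) (hint : IntegrableOn g I)
    (hcover : AECover (volume.restrict I) l fun i => Ioc (a i) (b i))
    (hab : ∀ᶠ i in l, a i ∈ I ∧ b i ∈ I ∧ a i ≤ b i) :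
    Tendsto (fun i => G (b i) - G (a i)) l (𝓝 (∫ x in I, g x)) := by
  refine (hcover.integral_tendsto_of_countably_generated hint).congr' (hab.mono ?_)
  rintro i ⟨ha, hb, hle⟩
  have hsub : Icc (a i) (b i) ⊆ I := hI.out ha hb
  rw [Measure.restrict_restrict measurableSet_Ioc,
    inter_eq_self_of_subset_left (Ioc_subset_Icc_self.trans hsub),
    ← intervalIntegral.integral_of_le hle]
  refine integral_eq_of_hasDerivAt_off_countable_of_le G g hle hs (hcont.mono hsub)
    (fun x hx => hd x ⟨hsub (Ioo_subset_Icc_self hx.1), hx.2⟩) ?_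
  exact (hint.mono_set ((uIcc_of_le hle).trans_subset hsub)).intervalIntegrable

theorem tendsto_nhdsGT_of_Ioi (hs : s.Countable) (hcont : ContinuousOn G (Ioi 0))
    (hd : ∀ x ∈ Ioi 0 \ s, HasDerivAt G (g x) x) (hint : IntegrableOn g (Ioi 0))
    (hG : Tendsto G atTop (𝓝 0)) : Tendsto G (𝓝[>] 0) (𝓝 (-∫ x in Ioi 0, g x)) := by
  have h := tendsto_sub_setIntegral (l := 𝓝[>] 0) (a := id) (b := fun x => x⁻¹)
    ordConnected_Ioi hs hcont hd hint
    ((aecover_Ioi_of_Ioi (tendsto_id'.2 nhdsWithin_le_nhds)).inter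
      (aecover_Iic tendsto_inv_nhdsGT_zero).restrict) ?_
  · simpa using (hG.comp tendsto_inv_nhdsGT_zero).sub h
  · filter_upwards [Ioc_mem_nhdsGT (zero_lt_one' ℝ)] with x hx
    exact ⟨hx.1, inv_pos.2 hx.1, hx.2.trans ((one_le_inv₀ hx.1).2 hx.2)⟩

theorem tendsto_nhdsGT_of_Ioo {e : ℝ} (he : 0 < e) (hs : s.Countable)
    (hcont : ContinuousOn G (Ioo 0 e)) (hd : ∀ x ∈ Ioo 0 e \ s, HasDerivAt G (g x) x)
    (hint : IntegrableOn g (Ioo 0 e)) (hG : Tendsto G (𝓝[<] e) (𝓝 0)) :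
    Tendsto G (𝓝[>] 0) (𝓝 (-∫ x in Ioo 0 e, g x)) := by
  have hright : Tendsto (fun x => e - x) (𝓝[>] 0) (𝓝 e) := by
    have hid : Tendsto id (𝓝[>] (0 : ℝ)) (𝓝 0) := tendsto_id'.2 nhdsWithin_le_nhds
    simpa using hid.const_sub e
  have h := tendsto_sub_setIntegral (l := 𝓝[>] 0) (a := id) (b := fun x => e - x)
    ordConnected_Ioo hs hcont hd hint
    (aecover_Ioo_of_Ioc (tendsto_id'.2 nhdsWithin_le_nhds) hright) ?_
  · have hright' : Tendsto (fun x => e - x) (𝓝[>] 0) (𝓝[<] e) :=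
      tendsto_nhdsWithin_iff.2 ⟨hright, eventually_mem_nhdsWithin.mono fun x hx =>
        sub_lt_self e (mem_Ioi.1 hx)⟩
    simpa using (hG.comp hright').sub h
  · filter_upwards [Ioo_mem_nhdsGT (half_pos he)] with x hx
    obtain ⟨hx0, hxe⟩ := hx
    simp only [id, mem_Ioo]
    exact ⟨⟨hx0, by linarith⟩, ⟨by linarith, by linarith⟩, by linarith⟩

end FundamentalTheorem

/-- The open intervals with left end `0`. -/
def StartsAtZero (I : Set ℝ) : Prop := I = Ioi 0 ∨ ∃ e > 0, I = Ioo 0 e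

namespace StartsAtZero

variable {I : Set ℝ} {x : ℝ}

theorem pos (hI : StartsAtZero I) (hx : x ∈ I) : 0 < x := by
  rcases hI with rfl | ⟨e, -, rfl⟩
  exacts [hx, hx.1]

theorem eventually_mem (hI : StartsAtZero I) : ∀ᶠ x in 𝓝[>] (0 : ℝ), x ∈ I := by
  rcases hI with rfl | ⟨e, he, rfl⟩
  exacts [self_mem_nhdsWithin, Ioo_mem_nhdsGT he]

end StartsAtZero

namespace DiffOp4

variable {L : DiffOp4} {I : Set ℝ} {p : ℝ → ℝ}

namespace IsWeight

variable {x : ℝ}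

theorem hasDerivAt (hw : L.IsWeight I p) (hI : IsOpen I) (hx : x ∈ I) (h4 : L.a₄.eval x ≠ 0) :
    HasDerivAt p (p x * (L.logDerivNum.eval x / (2 * L.a₄.eval x))) x := by
  obtain ⟨F, hF⟩ := hw
  have hp : p =ᶠ[𝓝 x] fun y => Real.exp (F y / 2 - Real.log (L.a₄.eval y)) := by
    filter_upwards [hI.mem_nhds hx, L.a₄.continuous.continuousAt.eventually_ne h4] with y hy hy4
    rw [(hF y hy hy4).2, Real.exp_sub, Real.exp_log_eq_abs hy4]
  have hd := (((hF x hx h4).1.div_const 2).sub ((L.a₄.hasDerivAt x).log h4)).exp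
  refine (hd.congr_of_eventuallyEq hp).congr_deriv ?_
  rw [hp.self_of_nhds]
  simp only [Pi.sub_apply, logDerivNum, eval_sub, eval_mul, eval_ofNat]
  field_simp

theorem hasDerivAt_mul (hw : L.IsWeight I p) (hI : IsOpen I) (hx : x ∈ I) (h4 : L.a₄.eval x ≠ 0) :
    HasDerivAt (fun x => p x * L.a₄.eval x) (p x * L.a₃.eval x / 2) x := by
  refine ((hw.hasDerivAt hI hx h4).mul (L.a₄.hasDerivAt x)).congr_deriv ?_
  simp only [logDerivNum, eval_sub, eval_mul, eval_ofNat]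
  field_simp
  ring

end IsWeight

namespace SelfAdjointWith

variable (H : L.SelfAdjointWith polyFunctions I p) {S R : ℝ[X]} {k : ℕ}
include H

theorem exists_abs_mul_le_of_Ioo {a b : ℝ} (h : ∀ x ∈ Ioo a b, L.a₄.eval x ≠ 0) :
    ∃ K, ∀ x ∈ Ioo a b, x ∈ I → |p x * L.a₄.eval x| ≤ K := by
  by_cases! hI : ∃ c ∈ Ioo a b, c ∈ I
  · obtain ⟨c, hc, hcI⟩ := hI
    refine ⟨|p c * L.a₄.eval c| + ∫ z in I, ‖p z * L.a₃.eval z / 2‖, fun x hx hxI => ?_⟩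
    have hsub := norm_sub_le_setIntegral_norm (G := fun z => p z * L.a₄.eval z) H.ordConnected
      ((H.admissible L.a₃).div_const 2) hcI hxI fun z hz =>
        H.weight.hasDerivAt_mul H.isOpen (H.ordConnected.uIcc_subset hcI hxI hz)
          (h z (ordConnected_Ioo.uIcc_subset hc hx hz))
    linarith [(abs_sub_abs_le_abs_sub _ _).trans hsub]
  · exact ⟨0, fun x hx hxI => (hI x hx hxI).elim⟩

theorem eventually_abs_mul_le (t : ℝ) :
    ∃ K, ∀ᶠ x in 𝓝[≠] t, x ∈ I → |p x * L.a₄.eval x| ≤ K := by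
  have hne := eventually_eval_ne_zero H.order_four.1 t
  rw [← nhdsLT_sup_nhdsGT, eventually_sup] at hne
  obtain ⟨a, ha, hleft⟩ := mem_nhdsLT_iff_exists_Ioo_subset.1 hne.1
  obtain ⟨b, hb, hright⟩ := mem_nhdsGT_iff_exists_Ioo_subset.1 hne.2
  obtain ⟨K, hK⟩ := H.exists_abs_mul_le_of_Ioo fun x hx => hleft hx
  obtain ⟨K', hK'⟩ := H.exists_abs_mul_le_of_Ioo fun x hx => hright hx
  refine ⟨max K K', ?_⟩
  rw [← nhdsLT_sup_nhdsGT, eventually_sup]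
  exact ⟨mem_of_superset (Ioo_mem_nhdsLT ha) fun x hx hxI => (hK x hx hxI).trans (le_max_left _ _),
    mem_of_superset (Ioo_mem_nhdsGT hb) fun x hx hxI => (hK' x hx hxI).trans (le_max_right _ _)⟩

theorem tendsto_mul_eval_div {t : ℝ} (ht : t ≠ 0) (hS : S.eval t = 0) (k : ℕ) :
    Tendsto (fun x => p x * L.a₄.eval x * (S.eval x / x ^ k)) (𝓝[I \ {t}] t) (𝓝 0) := by
  obtain ⟨K, hK⟩ := H.eventually_abs_mul_le t
  have hS0 : Tendsto (fun x => K * |S.eval x / x ^ k|) (𝓝[I \ {t}] t) (𝓝 0) := by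
    have := tendsto_eval_div S (X ^ k) (nhdsWithin_le_nhds (s := I \ {t})) (t := t) (by simp [ht])
    simpa [hS] using this.abs.const_mul K
  refine squeeze_zero_norm' ?_ hS0
  filter_upwards [nhdsWithin_mono t (fun x hx => hx.2) hK, self_mem_nhdsWithin] with x hx hxI
  rw [Real.norm_eq_abs, abs_mul]
  exact mul_le_mul_of_nonneg_right (hx hxI.1) (abs_nonneg _)

theorem continuousOn_mul_eval_div (hI0 : 0 ∉ I) (hS : ∀ t ∈ I, L.a₄.eval t = 0 → S.eval t = 0)
    (k : ℕ) : ContinuousOn (fun x => p x * L.a₄.eval x * (S.eval x / x ^ k)) I := by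
  intro t ht
  have ht0 : t ≠ 0 := ne_of_mem_of_not_mem ht hI0
  by_cases h4 : L.a₄.eval t = 0
  · rw [← continuousWithinAt_sdiff_self, ContinuousWithinAt]
    simpa only [h4, mul_zero, zero_mul] using H.tendsto_mul_eval_div ht0 (hS t ht h4) k
  · have hp := (H.weight.hasDerivAt H.isOpen ht h4).continuousAt
    exact ((hp.mul L.a₄.continuousAt).mul (S.continuousAt.div (continuousAt_pow t k)
      (pow_ne_zero k ht0))).continuousWithinAt

theorem tendsto_atTop_mul_eval_div (hI : I = Ioi 0)
    (hd : ∀ x ∈ I, L.a₄.eval x ≠ 0 →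
      HasDerivAt (fun x => p x * L.a₄.eval x * (S.eval x / x ^ k)) (p x * R.eval x) x) :
    Tendsto (fun x => p x * L.a₄.eval x * (S.eval x / x ^ k)) atTop (𝓝 0) := by
  obtain ⟨a, ha⟩ := eventually_atTop.1
    ((L.a₄.eventually_atTop_not_isRoot H.order_four.1).and (eventually_ge_atTop 1))
  have hsub : Ioi a ⊆ I := fun x hx => hI ▸ zero_lt_one.trans_le (ha x hx.out.le).2
  refine tendsto_zero_of_hasDerivAt_of_integrableOn_Ioi (a := a)
    (fun x hx => hd x (hsub hx) (ha x hx.out.le).1) ((H.admissible R).mono_set hsub) ?_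
  have hint : IntegrableOn (fun x => p x * (L.a₄ * S).eval x) (Ioi a) :=
    (H.admissible _).mono_set hsub
  have heq : (fun x => p x * L.a₄.eval x * (S.eval x / x ^ k))
      = fun x => (x ^ k)⁻¹ * (p x * (L.a₄ * S).eval x) := by
    ext x
    rw [eval_mul]
    ring
  rw [heq]
  refine hint.bdd_mul (c := 1)
    (by fun_prop : Measurable fun x : ℝ => (x ^ k)⁻¹).aestronglyMeasurable
    (ae_restrict_of_forall_mem measurableSet_Ioi fun x hx => ?_)
  have hx1 : 1 ≤ x := (ha x hx.out.le).2
  rw [norm_inv, norm_pow, Real.norm_of_nonneg (zero_le_one.trans hx1)]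
  exact inv_le_one_of_one_le₀ (one_le_pow₀ hx1)

theorem tendsto_nhdsGT_mul_eval_div (hI : StartsAtZero I)
    (hS : ∀ t ∈ I, L.a₄.eval t = 0 → S.eval t = 0) (hSe : ∀ e, I = Ioo 0 e → S.eval e = 0)
    (hd : ∀ x ∈ I, L.a₄.eval x ≠ 0 →
      HasDerivAt (fun x => p x * L.a₄.eval x * (S.eval x / x ^ k)) (p x * R.eval x) x)
    (hR : H.admissible.moment R = 0) :
    Tendsto (fun x => p x * L.a₄.eval x * (S.eval x / x ^ k)) (𝓝[>] 0) (𝓝 0) := by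
  have hroots := (L.a₄.finite_setOfPred_isRoot H.order_four.1).countable
  have hcont := H.continuousOn_mul_eval_div (fun h0 => (hI.pos h0).false) hS k
  have hd' : ∀ x ∈ I \ {x | L.a₄.IsRoot x}, _ := fun x hx => hd x hx.1 hx.2
  have hint := H.admissible R
  rw [AdmissibleWeight.moment_apply] at hR
  rcases hI with hI | ⟨e, he, hI⟩
  · have hlim := H.tendsto_atTop_mul_eval_div hI hd
    subst hI
    simpa only [hR, neg_zero] using tendsto_nhdsGT_of_Ioi hroots hcont hd' hint hlim
  · have hlim := H.tendsto_mul_eval_div he.ne' (hSe e hI) k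
    subst hI
    have hlim' := hlim.mono_left (nhdsWithin_mono e fun x (hx : x ∈ Ioo 0 e) => ⟨hx, hx.2.ne⟩)
    rw [nhdsWithin_Ioo_eq_nhdsLT he] at hlim'
    simpa only [hR, neg_zero] using tendsto_nhdsGT_of_Ioo he hroots hcont hd' hint hlim'

end SelfAdjointWith

end DiffOp4

theorem eq_zero_of_monotoneOn_abs {f : ℝ → ℝ} {b : ℝ} (hf : IntegrableOn f (Ioi b))
    (hmono : MonotoneOn (fun x => |f x|) (Ici b)) : f b = 0 := by
  have hconst : IntegrableOn (fun _ : ℝ => |f b|) (Ioi b) := by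
    refine Integrable.mono hf aestronglyMeasurable_const ?_
    filter_upwards [ae_restrict_mem measurableSet_Ioi] with x hx
    simpa using hmono self_mem_Ici hx.out.le hx.out.le
  rw [integrableOn_const_iff] at hconst
  simpa using hconst

namespace DiffOp4

variable {L : DiffOp4} {I : Set ℝ} {p : ℝ → ℝ} {x : ℝ}

/-- Four times the numerator over `a₄` of `½ a₃ w' + g w`, where `p g` is the coefficient of order
two in the symmetric form of the operator: the boundary term that comes from testing symmetry
against a primitive of `w`. -/
def boundaryNum (L : DiffOp4) (w : ℝ[X]) : ℝ[X] :=
  2 * L.a₄ * (L.a₃ * derivative w) + L.secondNum * w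

theorem boundaryNum_pow_three_mul (L : DiffOp4) (T v : ℝ[X]) :
    L.boundaryNum (T ^ 3 * v)
      = T ^ 2 * (2 * L.a₄ * L.a₃ * (3 * derivative T * v + T * derivative v)
        + L.secondNum * T * v) := by
  simp only [boundaryNum, derivative_mul, derivative_pow, Nat.cast_ofNat, map_ofNat]
  ring

theorem IsFormallySymmetric.boundaryNum_identity (h : L.IsFormallySymmetric) (w : ℝ[X]) :
    (L.logDerivNum - 2 * derivative L.a₄) * L.boundaryNum w
        + 2 * derivative (L.boundaryNum w) * L.a₄
      = 4 * L.a₄ ^ 2 * (L.a₃ * derivative (derivative w) + 2 * L.a₂ * derivative w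
        + 2 * L.a₁ * w) := by
  have hsecond : L.secondNum + L.logDerivNum * L.a₃
      = 4 * L.a₄ * L.a₂ - 2 * L.a₄ * derivative L.a₃ := by
    rw [secondNum]
    ring
  rw [IsFormallySymmetric] at h
  simp only [boundaryNum, derivative_add, derivative_mul, derivative_ofNat]
  linear_combination (2 * L.a₄ * derivative w) * hsecond - w * h

theorem IsWeight.hasDerivAt_boundary (hw : L.IsWeight I p) (hI : IsOpen I)
    (h : L.IsFormallySymmetric) (w : ℝ[X]) (hx : x ∈ I) (h4 : L.a₄.eval x ≠ 0) :
    HasDerivAt (fun x => p x * ((L.boundaryNum w).eval x / (4 * L.a₄.eval x)))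
      (p x * (C (1 / 2) * (L.a₃ * derivative (derivative w) + 2 * L.a₂ * derivative w
        + 2 * L.a₁ * w)).eval x) x := by
  have hd := (hw.hasDerivAt hI hx h4).mul (((L.boundaryNum w).hasDerivAt x).div
    ((L.a₄.hasDerivAt x).const_mul 4) (mul_ne_zero four_ne_zero h4))
  refine hd.congr_deriv ?_
  have hid := congrArg (eval x) (h.boundaryNum_identity w)
  simp only [eval_mul, eval_add, eval_sub, eval_pow, eval_ofNat, eval_C, Pi.div_apply] at hid ⊢
  field_simp
  linear_combination p x * hid

theorem IsWeight.hasDerivAt_sq_mul (hw : L.IsWeight I p) (hI : IsOpen I) (hx : x ∈ I)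
    (h4 : L.a₄.eval x ≠ 0) :
    HasDerivAt (fun x => (p x * L.a₄.eval x) ^ 2)
      ((p x * L.a₄.eval x) ^ 2 * (L.a₃.eval x / L.a₄.eval x)) x := by
  refine ((hw.hasDerivAt_mul hI hx h4).pow 2).congr_deriv ?_
  field_simp
  ring

namespace SelfAdjointWith

variable (H : L.SelfAdjointWith polyFunctions I p)
include H

section LeftEnd

variable (hI : StartsAtZero I) {r u : ℝ[X]} {m : ℕ}
include hI

theorem eventually_mem_left :
    ∀ᶠ x in 𝓝[>] (0 : ℝ), 0 < x ∧ x ∈ I ∧ L.a₄.eval x ≠ 0 := by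
  have h4 := (eventually_eval_ne_zero H.order_four.1 0).filter_mono
    (nhdsWithin_mono _ fun x (hx : 0 < x) => hx.ne')
  filter_upwards [self_mem_nhdsWithin, hI.eventually_mem, h4] with x h0 hx hx4
  exact ⟨h0, hx, hx4⟩

omit H in
theorem exists_cutoff (hr : L.a₄ = X ^ m * r) :
    ∃ e ≠ 0, (∀ t ∈ I, L.a₄.eval t = 0 → (r * (X - C e)).eval t = 0) ∧
      ∀ e', I = Ioo 0 e' → (r * (X - C e)).eval e' = 0 := by
  have hroot : ∀ e, ∀ t ∈ I, L.a₄.eval t = 0 → (r * (X - C e)).eval t = 0 := by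
    intro e t ht h
    rw [hr, eval_mul, eval_pow, eval_X] at h
    rw [eval_mul, (mul_eq_zero.1 h).resolve_left (pow_ne_zero _ (hI.pos ht).ne'), zero_mul]
  by_cases! hb : ∃ e > 0, I = Ioo 0 e
  · obtain ⟨e, he, rfl⟩ := hb
    refine ⟨e, he.ne', hroot e, fun e' he' => ?_⟩
    rw [← csSup_Ioo he, he', csSup_Ioo (nonempty_Ioo.1 (he' ▸ nonempty_Ioo.2 he))]
    simp
  · refine ⟨1, one_ne_zero, hroot 1, fun e' he' => (hb e' ?_ he').elim⟩
    obtain ⟨x, hx⟩ := hI.eventually_mem.exists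
    rw [he'] at hx
    exact hx.1.trans hx.2

theorem tendsto_mul_a₄ : Tendsto (fun x => p x * L.a₄.eval x) (𝓝[>] 0) (𝓝 0) := by
  obtain ⟨r, hr, hr0⟩ := exists_eq_pow_rootMultiplicity_mul_and_not_dvd L.a₄ H.order_four.1 0
  rw [C_0, sub_zero] at hr
  rw [dvd_iff_isRoot, IsRoot.def] at hr0
  obtain ⟨e, he, hS, hSe⟩ := exists_cutoff hI hr
  set T := r * (X - C e)
  have hT0 : T.eval 0 ≠ 0 := by simp [T, hr0, he]
  have hd : ∀ x ∈ I, L.a₄.eval x ≠ 0 →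
      HasDerivAt (fun x => p x * L.a₄.eval x * (T.eval x / x ^ 0))
        (p x * (C (1 / 2) * (2 * L.a₄ * derivative T + L.a₃ * T)).eval x) x := by
    intro x hx h4
    simp only [pow_zero, div_one]
    refine ((H.weight.hasDerivAt_mul H.isOpen hx h4).mul (T.hasDerivAt x)).congr_deriv ?_
    simp only [eval_add, eval_mul, eval_C, eval_ofNat]
    ring
  have hlim := H.tendsto_nhdsGT_mul_eval_div hI hS hSe hd
    (by rw [AdmissibleWeight.moment_C_mul, H.moment_pearson, mul_zero])
  have hdiv := hlim.div (tendsto_eval T nhdsWithin_le_nhds) hT0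
  rw [zero_div] at hdiv
  refine hdiv.congr' ?_
  filter_upwards [(T.continuous.continuousAt.eventually_ne hT0).filter_mono nhdsWithin_le_nhds]
    with x hx
  rw [Pi.div_apply, pow_zero, div_one, mul_div_cancel_right₀ _ hx]

theorem exists_tendsto_boundaryNum (hr : L.a₄ = X ^ m * r) (hr0 : r.eval 0 ≠ 0) :
    ∃ T : ℝ[X], T.eval 0 ≠ 0 ∧ ∀ v : ℝ[X], Tendsto
      (fun x => p x * ((L.boundaryNum (T * v)).eval x / (4 * L.a₄.eval x))) (𝓝[>] 0) (𝓝 0) := by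
  obtain ⟨e, he, hS, hSe⟩ := exists_cutoff hI hr
  set ρ := X - C e with hρ
  set T := r * ρ with hT
  refine ⟨T ^ 3, by simp [hT, hρ, hr0, he], fun v => ?_⟩
  -- `S = x ^ (2 m) * boundaryNum / (4 a₄ ^ 2)`, a polynomial still divisible by `T`.
  set S := T * (C (1 / 4) * (2 * L.a₃ * X ^ m * ρ * (3 * derivative T * v + T * derivative v)
    + L.secondNum * ρ ^ 2 * v)) with hSdef
  have hform : ∀ x, L.a₄.eval x ≠ 0 → p x * L.a₄.eval x * (S.eval x / x ^ (2 * m)) =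
      p x * ((L.boundaryNum (T ^ 3 * v)).eval x / (4 * L.a₄.eval x)) := by
    intro x hx
    rw [hr, eval_mul, eval_pow, eval_X] at hx ⊢
    obtain ⟨hxm, hrx⟩ := mul_ne_zero_iff.1 hx
    rw [boundaryNum_pow_three_mul, hSdef, hT, hr]
    simp only [eval_mul, eval_add, eval_pow, eval_X, eval_C, eval_ofNat, pow_mul']
    field_simp
  have hd := fun x hx h4 => (H.weight.hasDerivAt_boundary H.isOpen H.isFormallySymmetric
    (T ^ 3 * v) (x := x) hx h4).congr_of_eventuallyEq
      ((L.a₄.continuous.continuousAt.eventually_ne h4).mono hform)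
  have hlim := H.tendsto_nhdsGT_mul_eval_div hI
    (fun t ht h4 => by rw [hSdef, eval_mul, hS t ht h4, zero_mul])
    (fun e he => by rw [hSdef, eval_mul, hSe e he, zero_mul]) hd
    (by rw [AdmissibleWeight.moment_C_mul, H.moment_symmetry, mul_zero])
  exact hlim.congr' ((H.eventually_mem_left hI).mono fun x hx => hform x hx.2.2)

theorem eq_zero_of_a₃_mul_eq (h : L.a₃ * r = L.a₄ * u) : r.eval 0 = 0 := by
  by_contra hr
  have hlim := (H.tendsto_mul_a₄ hI).pow 2
  rw [zero_pow two_ne_zero] at hlim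
  have hr' : ∀ᶠ x in 𝓝[>] (0 : ℝ), r.eval x ≠ 0 :=
    (r.continuous.continuousAt.eventually_ne hr).filter_mono nhdsWithin_le_nhds
  obtain ⟨c, hc, hcf⟩ := exists_pos_le_of_logDeriv_eq_div
    (f := fun x => (p x * L.a₄.eval x) ^ 2) (u := u) hr (by
      filter_upwards [H.eventually_mem_left hI, hr'] with x ⟨_, hx, h4⟩ hrx
      have hp := H.weight.pos hx h4
      refine ⟨by positivity, ?_⟩
      refine (H.weight.hasDerivAt_sq_mul H.isOpen hx h4).congr_deriv ?_
      rw [(div_eq_div_iff h4 hrx).2]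
      rw [← eval_mul, h, eval_mul, mul_comm])
  exact absurd (ge_of_tendsto hlim hcf) hc.not_ge

theorem exists_pos_le_mul_zpow (hr : L.a₄ = X ^ m * r) (hr0 : r.eval 0 ≠ 0) (j : ℤ)
    (hu : X * L.logDerivNum + C (2 * (j : ℝ)) * L.a₄ = X ^ (m + 1) * u) :
    ∃ c > 0, ∀ᶠ x in 𝓝[>] (0 : ℝ), c ≤ p x * x ^ j := by
  refine exists_pos_le_of_logDeriv_eq_div (u := u) (w := C 2 * r) (by simpa using hr0) ?_
  filter_upwards [H.eventually_mem_left hI] with x ⟨h0, hx, h4⟩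
  have hp := H.weight.pos hx h4
  refine ⟨by positivity, ((H.weight.hasDerivAt H.isOpen hx h4).mul
    (hasDerivAt_zpow j x (Or.inl h0.ne'))).congr_deriv ?_⟩
  have hux := congrArg (eval x) hu
  rw [hr, eval_mul, eval_pow, eval_X] at h4
  obtain ⟨hxm, hrx⟩ := mul_ne_zero_iff.1 h4
  simp only [hr, eval_mul, eval_add, eval_pow, eval_X, eval_C, pow_succ] at hux ⊢
  rw [zpow_sub_one₀ h0.ne']
  field_simp
  linear_combination hux

theorem eval_eq_zero_of_boundaryNum_eq {w A : ℝ[X]} {k : ℕ} (hr : L.a₄ = X ^ m * r)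
    (hr0 : r.eval 0 ≠ 0) (hu : X * L.logDerivNum - C (2 * (k : ℝ)) * L.a₄ = X ^ (m + 1) * u)
    (hA : X ^ k * L.boundaryNum w = X ^ m * A)
    (hlim : Tendsto (fun x => p x * ((L.boundaryNum w).eval x / (4 * L.a₄.eval x)))
      (𝓝[>] 0) (𝓝 0)) : A.eval 0 = 0 := by
  obtain ⟨c, hc, hcp⟩ := H.exists_pos_le_mul_zpow hI hr hr0 (-k) (u := u) (by
    rw [← hu, Int.cast_neg, Int.cast_natCast, mul_neg, C_neg, neg_mul, sub_eq_add_neg])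
  refine eval_eq_zero_of_tendsto_mul_div (w := C 4 * r) (by simpa using hr0) hc hcp
    (hlim.congr' ?_)
  filter_upwards [H.eventually_mem_left hI] with x ⟨h0, _, h4⟩
  have hAx := congrArg (eval x) hA
  rw [hr, eval_mul, eval_pow, eval_X] at h4 ⊢
  obtain ⟨hxm, hrx⟩ := mul_ne_zero_iff.1 h4
  simp only [eval_mul, eval_pow, eval_X, eval_C, zpow_neg, zpow_natCast] at hAx ⊢
  field_simp
  linear_combination (p x) * hAx

theorem eval_a₄_left_end : L.a₄.eval 0 = 0 :=
  H.eq_zero_of_a₃_mul_eq hI (mul_comm _ _)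

theorem eval_derivative_a₄_left_end : (derivative L.a₄).eval 0 = 0 := by
  have h4 := H.eval_a₄_left_end hI
  obtain ⟨r, hr⟩ : X ∣ L.a₄ := X_dvd_iff.2 (by rwa [coeff_zero_eq_eval_zero])
  have hr1 : L.a₄ = X ^ 1 * r := by rw [pow_one, hr]
  have hd : (derivative L.a₄).eval 0 = r.eval 0 := by simp [hr, derivative_mul]
  rw [hd]
  by_contra hr0
  have h3 : L.a₃.eval 0 ≠ 0 := by
    intro h3
    obtain ⟨u, hu⟩ : X ∣ L.a₃ := X_dvd_iff.2 (by rwa [coeff_zero_eq_eval_zero])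
    exact hr0 (H.eq_zero_of_a₃_mul_eq hI (u := u) (by rw [hu, hr]; ring))
  have hn : L.logDerivNum.eval 0 = L.a₃.eval 0 - 2 * r.eval 0 := by simp [logDerivNum, hd]
  have hs : L.secondNum.eval 0 = -(L.logDerivNum.eval 0 * L.a₃.eval 0) := by simp [secondNum, h4]
  have hcases : L.a₃.eval 0 = 4 * r.eval 0 ∨ L.a₃.eval 0 = 2 * r.eval 0 := by
    have hfs := congrArg (eval 0) H.isFormallySymmetric
    simp only [eval_mul, eval_add, eval_sub, eval_pow, eval_ofNat, h4, hd, hs, hn] at hfs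
    rw [← sub_eq_zero, ← sub_eq_zero (b := 2 * r.eval 0), ← mul_eq_zero]
    refine mul_right_cancel₀ h3 ?_
    linear_combination hfs
  obtain ⟨T, hT, hlim⟩ := H.exists_tendsto_boundaryNum hI hr1 hr0
  rcases hcases with h | h
  · obtain ⟨u, hu⟩ : X ∣ L.logDerivNum - 2 * r := X_dvd_iff.2 (by
      rw [coeff_zero_eq_eval_zero, eval_sub, hn, eval_mul, eval_ofNat, h]; ring)
    have hA := H.eval_eq_zero_of_boundaryNum_eq hI (k := 1) (u := u) hr1 hr0
      (by rw [hr, Nat.cast_one, mul_one, map_ofNat]; linear_combination X * hu) rfl (hlim 1)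
    rw [mul_one, boundaryNum] at hA
    simp only [eval_add, eval_mul, eval_ofNat, h4, mul_zero, zero_mul, hs, hn, neg_mul, zero_add,
      neg_eq_zero, mul_eq_zero, h3, or_false, hT] at hA
    exact hr0 (by linarith)
  · obtain ⟨u, hu⟩ : X ∣ L.logDerivNum := X_dvd_iff.2 (by
      rw [coeff_zero_eq_eval_zero, hn, h, sub_self])
    have hA := H.eval_eq_zero_of_boundaryNum_eq hI (k := 0) (u := u) hr1 hr0
      (A := 2 * r * (L.a₃ * derivative (T * X)) + L.secondNum * T)
      (by simp only [hu, CharP.cast_eq_zero, mul_zero, map_zero]; ring)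
      (by simp only [boundaryNum, hr]; ring) (hlim X)
    simp [hs, hn, h, hr0, hT] at hA

theorem eval_a₂_left_end (hr : L.a₄ = X ^ 2 * r) (hr0 : r.eval 0 ≠ 0)
    (hu : L.logDerivNum = X ^ 2 * u) : 2 * L.a₂.eval 0 = (derivative L.a₃).eval 0 := by
  have h3 : L.a₃.eval 0 = 0 := by
    have hsum : L.a₃ = X ^ 2 * u + 2 * derivative (X ^ 2 * r) := by
      rw [← hu, ← hr, logDerivNum]
      ring
    simp [hsum, derivative_mul]
  obtain ⟨T, hT, hlim⟩ := H.exists_tendsto_boundaryNum hI hr hr0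
  have hA := H.eval_eq_zero_of_boundaryNum_eq hI (k := 0) (u := u) hr hr0
    (A := 2 * r * (L.a₃ * derivative (T * 1))
      + (4 * r * L.a₂ - 2 * r * derivative L.a₃ - u * L.a₃) * (T * 1))
    (by simp only [hu, CharP.cast_eq_zero, mul_zero, map_zero]; ring)
    (by simp only [boundaryNum, secondNum, hr, hu]; ring) (hlim 1)
  simp only [eval_mul, eval_add, eval_sub, eval_ofNat, h3, mul_zero, zero_mul, zero_add,
    mul_one, sub_zero] at hA
  refine mul_left_cancel₀ (mul_ne_zero two_ne_zero hr0) ?_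
  linear_combination (mul_eq_zero.1 hA).resolve_right hT

end LeftEnd

section InfiniteEnd

variable {x₀ : ℝ} (hI : Ioi x₀ ⊆ I)
include hI

theorem frequently_mul_div_lt (j : ℕ) :
    ∃ᶠ x in atTop, x * (L.a₃.eval x / L.a₄.eval x) < -(2 * j : ℝ) := by
  intro h
  simp only [not_lt] at h
  obtain ⟨b, hb⟩ := eventually_atTop.1 ((h.and (L.a₄.eventually_atTop_not_isRoot
    H.order_four.1)).and ((eventually_gt_atTop x₀).and (eventually_gt_atTop 0)))
  set G := fun x => p x * L.a₄.eval x * x ^ j with hG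
  have hderiv : ∀ x ∈ Ici b, HasDerivAt (fun x => G x ^ 2)
      (G x ^ 2 / x * (x * (L.a₃.eval x / L.a₄.eval x) + 2 * j)) x := by
    intro x hx
    obtain ⟨⟨-, (h4 : _ ≠ 0)⟩, hx0, hx1⟩ := hb x hx
    have hpow := ((hasDerivAt_zpow j x (.inl hx1.ne')).pow 2).congr_deriv
      (g' := 2 * j * (x ^ j) ^ 2 / x) (by
        rw [zpow_sub_one₀ hx1.ne', zpow_natCast]
        push_cast
        field_simp)
    simp only [hG, mul_pow _ (_ ^ j)]
    refine ((H.weight.hasDerivAt_sq_mul H.isOpen (hI hx0) h4).mul hpow).congr_deriv ?_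
    simp only [Pi.pow_apply, zpow_natCast]
    field_simp
  have hmono : MonotoneOn (fun x => |G x|) (Ici b) := by
    have hsq : MonotoneOn (fun x => G x ^ 2) (Ici b) :=
      monotoneOn_of_hasDerivWithinAt_nonneg (convex_Ici b)
        (fun x hx => (hderiv x hx).continuousAt.continuousWithinAt)
        (fun x hx => (hderiv x (interior_subset hx)).hasDerivWithinAt) fun x hx => by
          obtain ⟨⟨hbound, -⟩, -, hx1⟩ := hb x (interior_subset hx)
          exact mul_nonneg (by positivity) (by linarith)
    exact fun x hx y hy hxy => sq_le_sq.1 (hsq hx hy hxy)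
  obtain ⟨⟨-, h4⟩, hx0, hx1⟩ := hb b le_rfl
  have hint : IntegrableOn G (Ioi b) := by
    refine IntegrableOn.congr_fun ((H.admissible (L.a₄ * X ^ j)).mono_set
      ((Ioi_subset_Ioi hx0.le).trans hI)) (fun x _ => ?_) measurableSet_Ioi
    simp only [hG, eval_mul, eval_pow, eval_X, mul_assoc]
  exact mul_ne_zero (mul_ne_zero (H.weight.pos (hI hx0) h4).ne' h4) (pow_ne_zero j hx1.ne')
    (eq_zero_of_monotoneOn_abs (f := G) hint hmono)

theorem a₃_ne_zero_of_Ioi_subset : L.a₃ ≠ 0 := by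
  intro h3
  obtain ⟨x, hx⟩ := (H.frequently_mul_div_lt hI 0).exists
  simp [h3] at hx

theorem natDegree_a₄_le_of_Ioi_subset : L.a₄.natDegree ≤ L.a₃.natDegree := by
  have h3 := H.a₃_ne_zero_of_Ioi_subset hI
  by_contra! hlt
  have hdeg : (X * L.a₃).degree ≤ L.a₄.degree := by
    rw [degree_eq_natDegree (mul_ne_zero X_ne_zero h3), degree_eq_natDegree H.order_four.1,
      natDegree_X_mul h3]
    exact_mod_cast hlt
  obtain ⟨c, hc⟩ := (isBigO_atTop_of_degree_le _ _ hdeg).bound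
  obtain ⟨j, hj⟩ := exists_nat_ge c
  refine H.frequently_mul_div_lt hI j ?_
  filter_upwards [hc, L.a₄.eventually_atTop_not_isRoot H.order_four.1] with x hx (hx4 : _ ≠ 0)
  rw [eval_mul, eval_X, Real.norm_eq_abs, Real.norm_eq_abs, ← div_le_iff₀ (abs_pos.2 hx4),
    ← abs_div, mul_div_assoc] at hx
  linarith [(abs_le.1 hx).1, j.cast_nonneg (α := ℝ)]

theorem leadingCoeff_mul_neg_of_Ioi_subset : L.a₃.leadingCoeff * L.a₄.leadingCoeff < 0 := by
  by_contra! hnn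
  have hev : ∀ᶠ x in atTop, 0 ≤ (L.a₃ * L.a₄).eval x := by
    rw [← leadingCoeff_mul] at hnn
    rcases le_or_gt (L.a₃ * L.a₄).degree 0 with hd | hd
    · rw [eq_C_of_degree_le_zero hd] at hnn ⊢
      exact Eventually.of_forall fun x => by simpa only [eval_C, leadingCoeff_C] using hnn
    · exact (tendsto_atTop_of_leadingCoeff_nonneg _ hd hnn).eventually_ge_atTop 0
  refine H.frequently_mul_div_lt hI 0 ?_
  filter_upwards [hev, eventually_ge_atTop 0] with x hx hx0
  rw [eval_mul] at hx
  have hdiv : 0 ≤ L.a₃.eval x / L.a₄.eval x := by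
    rcases mul_nonneg_iff.1 hx with ⟨h3, h4⟩ | ⟨h3, h4⟩
    · exact div_nonneg h3 h4
    · exact div_nonneg_of_nonpos h3 h4
  simpa using mul_nonneg hx0 hdiv

end InfiniteEnd

end SelfAdjointWith

end DiffOp4

section TemperateGrowth

theorem hasDerivAt_iteratedDeriv {𝕜 F : Type*} [NontriviallyNormedField 𝕜] [NormedAddCommGroup F]
    [NormedSpace 𝕜 F] {n : WithTop ℕ∞} {k : ℕ} {u : 𝕜 → F} (hu : ContDiff 𝕜 n u) (hk : k < n)
    (x : 𝕜) : HasDerivAt (iteratedDeriv k u) (iteratedDeriv (k + 1) u x) x := by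
  rw [iteratedDeriv_succ]
  exact (hu.differentiable_iteratedDeriv k hk x).hasDerivAt

variable {f g : ℝ → ℝ}

theorem hasTemperateGrowth_iteratedDeriv (hf : f.HasTemperateGrowth) (k : ℕ) :
    (iteratedDeriv k f).HasTemperateGrowth := by
  rw [iteratedDeriv_eq_iterate]
  refine ⟨hf.1.iterate_deriv k, fun n => ?_⟩
  obtain ⟨m, C, h⟩ := hf.2 (n + k)
  refine ⟨m, C, fun x => ?_⟩
  simpa only [norm_iteratedFDeriv_eq_norm_iteratedDeriv, iteratedDeriv_eq_iterate,
    Function.iterate_add_apply] using h x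

theorem hasTemperateGrowth_eval (q : ℝ[X]) :
    Function.HasTemperateGrowth fun x : ℝ => q.eval x := by
  induction q using Polynomial.induction_on' with
  | add p q hp hq =>
    simp only [eval_add]
    exact hp.add hq
  | monomial n a =>
    simp only [eval_monomial]
    exact (Function.HasTemperateGrowth.const a).mul (Function.HasTemperateGrowth.id'.pow n)

theorem AdmissibleWeight.integrableOn_mul {I : Set ℝ} {p : ℝ → ℝ} (h : AdmissibleWeight I p)
    (hf : f.HasTemperateGrowth) : IntegrableOn (fun x => p x * f x) I := by
  obtain ⟨k, c, hc⟩ := hf.2 0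
  have hle (x : ℝ) : |f x| ≤ |c| * 2 ^ k * (1 + x ^ 2) ^ k := by
    have hbound := hc x
    rw [norm_iteratedFDeriv_zero, Real.norm_eq_abs, Real.norm_eq_abs] at hbound
    have hsq : 1 + |x| ≤ 2 * (1 + x ^ 2) := by nlinarith [sq_nonneg (|x| - 1), sq_abs x]
    calc |f x| ≤ c * (1 + |x|) ^ k := hbound
      _ ≤ |c| * (2 * (1 + x ^ 2)) ^ k := by gcongr; exact le_abs_self c
      _ = _ := by rw [mul_pow, mul_assoc]
  refine Integrable.mono (h (C (|c| * 2 ^ k) * (1 + X ^ 2) ^ k)) ?_ (ae_of_all _ fun x => ?_)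
  · have hmeas : AEStronglyMeasurable p (volume.restrict I) := by
      simpa using (h 1).aestronglyMeasurable
    exact hmeas.mul hf.1.continuous.aestronglyMeasurable
  · rw [norm_mul, norm_mul]
    refine mul_le_mul_of_nonneg_left ?_ (norm_nonneg _)
    simpa using (hle x).trans (le_abs_self _)

theorem AdmissibleWeight.integrableOn_mul_mul {I : Set ℝ} {p : ℝ → ℝ} (h : AdmissibleWeight I p)
    (hf : f.HasTemperateGrowth) (hg : g.HasTemperateGrowth) :
    IntegrableOn (fun x => p x * (f x * g x)) I :=
  h.integrableOn_mul (hf.mul hg)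

end TemperateGrowth

section Pearson

variable {q τ : ℝ[X]} {c : ℝ} {I : Set ℝ} {p u v w : ℝ → ℝ}

/-- The hypergeometric operator `T u = q u'' + τ u'`. -/
def secondAct (q τ : ℝ[X]) (u : ℝ → ℝ) (x : ℝ) : ℝ :=
  q.eval x * iteratedDeriv 2 u x + τ.eval x * iteratedDeriv 1 u x

/-- The coefficients of `T² + c T`, where `T = q D² + τ D`. -/
def quadraticOp (q τ : ℝ[X]) (c : ℝ) : DiffOp4 where
  a₄ := q ^ 2
  a₃ := 2 * q * (derivative q + τ)
  a₂ := q * (derivative (derivative q) + 2 * derivative τ) + τ * (derivative q + τ) + C c * q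
  a₁ := q * derivative (derivative τ) + τ * derivative τ + C c * τ

theorem hasTemperateGrowth_secondAct (q τ : ℝ[X]) (hu : u.HasTemperateGrowth) :
    (secondAct q τ u).HasTemperateGrowth :=
  ((hasTemperateGrowth_eval q).mul (hasTemperateGrowth_iteratedDeriv hu 2)).add
    ((hasTemperateGrowth_eval τ).mul (hasTemperateGrowth_iteratedDeriv hu 1))

theorem act_quadraticOp (q τ : ℝ[X]) (c : ℝ) (hu : ContDiff ℝ 4 u) (x : ℝ) :
    (quadraticOp q τ c).act u x = secondAct q τ (secondAct q τ u) x + c * secondAct q τ u x := by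
  have hd (k : ℕ) (hk : k < 4 := by norm_num) (x : ℝ) :=
    hasDerivAt_iteratedDeriv hu (k := k) (by exact_mod_cast hk) x
  have hone (x : ℝ) : iteratedDeriv 1 (secondAct q τ u) x =
      (derivative q).eval x * iteratedDeriv 2 u x + q.eval x * iteratedDeriv 3 u x +
        ((derivative τ).eval x * iteratedDeriv 1 u x + τ.eval x * iteratedDeriv 2 u x) := by
    rw [iteratedDeriv_one]
    exact (((q.hasDerivAt x).mul (hd 2 (x := x))).add
      ((τ.hasDerivAt x).mul (hd 1 (x := x)))).deriv
  have htwo := ((((derivative q).hasDerivAt x).mul (hd 2 (x := x))).add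
    ((q.hasDerivAt x).mul (hd 3 (x := x)))).add
    ((((derivative τ).hasDerivAt x).mul (hd 1 (x := x))).add
      ((τ.hasDerivAt x).mul (hd 2 (x := x)))) |>.deriv
  have hsucc : iteratedDeriv 2 (secondAct q τ u) x = _ :=
    (congrFun (iteratedDeriv_succ.trans (congrArg deriv (funext hone))) x).trans htwo
  have hunfold (v : ℝ → ℝ) : secondAct q τ v x =
      q.eval x * iteratedDeriv 2 v x + τ.eval x * iteratedDeriv 1 v x := rfl
  rw [hunfold (secondAct q τ u), hsucc, hone, hunfold]
  simp only [DiffOp4.act, quadraticOp, ← iteratedDeriv_one, eval_add, eval_mul, eval_pow, eval_C,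
    eval_ofNat]
  ring

/-- Pearson's differential equation `(p q)' = p τ`, which says that `q D² + τ D` is formally
symmetric with respect to `p`. -/
structure IsPearsonWeight (q τ : ℝ[X]) (I : Set ℝ) (p : ℝ → ℝ) : Prop where
  pos : ∀ x ∈ I, 0 < p x
  pos_mul : ∀ x ∈ I, 0 < p x * q.eval x
  hasDerivAt : ∀ x ∈ I, HasDerivAt (fun x => p x * q.eval x) (p x * τ.eval x) x

/-- Pearson's equation integrated against test functions, which also encodes that the boundary
terms vanish. -/
def WeakPearson (q τ : ℝ[X]) (I : Set ℝ) (p : ℝ → ℝ) : Prop :=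
  ∀ w : ℝ → ℝ, w.HasTemperateGrowth →
    ∫ x in I, p x * (q.eval x * iteratedDeriv 1 w x + τ.eval x * w x) = 0

theorem WeakPearson.integral_secondAct_mul (h : WeakPearson q τ I p) (hp : AdmissibleWeight I p)
    (hu : u.HasTemperateGrowth) (hv : v.HasTemperateGrowth) :
    ∫ x in I, p x * (secondAct q τ u x * v x) = ∫ x in I, p x * (u x * secondAct q τ v x) := by
  have hd {f : ℝ → ℝ} (hf : f.HasTemperateGrowth) (k : ℕ) (x : ℝ) :=
    hasDerivAt_iteratedDeriv hf.1 (k := k) (mod_cast WithTop.coe_lt_top _) x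
  -- `T u * v - u * T v = q w' + τ w` for the Wronskian `w = u' v - u v'`.
  have hw : Function.HasTemperateGrowth (iteratedDeriv 1 u * v - u * iteratedDeriv 1 v) :=
    ((hasTemperateGrowth_iteratedDeriv hu 1).mul hv).sub
      (Function.HasTemperateGrowth.mul hu (hasTemperateGrowth_iteratedDeriv hv 1))
  have hw' (x : ℝ) : iteratedDeriv 1 (iteratedDeriv 1 u * v - u * iteratedDeriv 1 v) x =
      iteratedDeriv 2 u x * v x - u x * iteratedDeriv 2 v x := by
    have hu0 : HasDerivAt u (iteratedDeriv 1 u x) x := by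
      simpa only [iteratedDeriv_zero] using hd hu 0 x
    have hv0 : HasDerivAt v (iteratedDeriv 1 v x) x := by
      simpa only [iteratedDeriv_zero] using hd hv 0 x
    rw [iteratedDeriv_one, (((hd hu 1 x).mul hv0).sub (hu0.mul (hd hv 1 x))).deriv]
    ring
  rw [← sub_eq_zero, ← integral_sub
    (hp.integrableOn_mul_mul (hasTemperateGrowth_secondAct q τ hu) hv)
    (hp.integrableOn_mul_mul hu (hasTemperateGrowth_secondAct q τ hv)),
    ← h _ hw]
  congr 1 with x
  simp only [hw', secondAct, Pi.sub_apply, Pi.mul_apply]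
  ring

theorem WeakPearson.symmetricOn (h : WeakPearson q τ I p) (hp : AdmissibleWeight I p) (c : ℝ) :
    (quadraticOp q τ c).SymmetricOn {f | Function.HasTemperateGrowth f} I p := by
  intro u hu v hv
  have hTu := hasTemperateGrowth_secondAct q τ hu
  have hTv := hasTemperateGrowth_secondAct q τ hv
  have hact (f : ℝ → ℝ) (hf : f.HasTemperateGrowth) (x : ℝ) :=
    act_quadraticOp q τ c (isTestSpace_hasTemperateGrowth.contDiff f hf) x
  calc ∫ x in I, p x * (quadraticOp q τ c).act u x * v x
      = (∫ x in I, p x * (secondAct q τ (secondAct q τ u) x * v x))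
        + c * ∫ x in I, p x * (secondAct q τ u x * v x) := by
        rw [← integral_const_mul, ← integral_add
          (hp.integrableOn_mul_mul (hasTemperateGrowth_secondAct q τ hTu) hv)
          ((hp.integrableOn_mul_mul hTu hv).const_mul c)]
        congr 1 with x
        rw [hact u hu]
        ring
    _ = (∫ x in I, p x * (u x * secondAct q τ (secondAct q τ v) x))
        + c * ∫ x in I, p x * (u x * secondAct q τ v x) := by
        rw [h.integral_secondAct_mul hp hTu hv, h.integral_secondAct_mul hp hu hTv,
          h.integral_secondAct_mul hp hu hv]
    _ = ∫ x in I, p x * u x * (quadraticOp q τ c).act v x := by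
        rw [← integral_const_mul, ← integral_add
          (hp.integrableOn_mul_mul hu (hasTemperateGrowth_secondAct q τ hTv))
          ((hp.integrableOn_mul_mul hu hTv).const_mul c)]
        congr 1 with x
        rw [hact v hv]
        ring

namespace IsPearsonWeight

theorem isWeight (h : IsPearsonWeight q τ I p) (c : ℝ) : (quadraticOp q τ c).IsWeight I p := by
  refine ⟨fun x => 2 * Real.log (p x * q.eval x * q.eval x), fun x hx _ => ?_⟩
  have hpx := h.pos x hx
  have hq : 0 < q.eval x := (pos_iff_pos_of_mul_pos (h.pos_mul x hx)).1 hpx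
  constructor
  · refine ((((h.hasDerivAt x hx).mul (q.hasDerivAt x)).log
      (mul_pos (h.pos_mul x hx) hq).ne').const_mul 2).congr_deriv ?_
    simp only [quadraticOp, eval_mul, eval_add, eval_pow, eval_ofNat, Pi.mul_apply]
    field_simp
    ring
  · rw [mul_div_cancel_left₀ _ (two_ne_zero' ℝ), Real.exp_log (by positivity), quadraticOp,
      eval_pow, abs_of_pos (by positivity)]
    field_simp

theorem hasDerivAt_mul (h : IsPearsonWeight q τ I p) (hw : w.HasTemperateGrowth) :
    ∀ x ∈ I, HasDerivAt (fun x => p x * (q.eval x * w x))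
      (p x * (q.eval x * iteratedDeriv 1 w x + τ.eval x * w x)) x := fun x hx => by
  have hwx : HasDerivAt w (iteratedDeriv 1 w x) x := by
    rw [iteratedDeriv_one]
    exact (hw.1.differentiable (by simp) x).hasDerivAt
  refine (((h.hasDerivAt x hx).mul hwx).congr_deriv (by ring)).congr_of_eventuallyEq
    (Eventually.of_forall fun y => ?_)
  simp only [Pi.mul_apply, mul_assoc]

theorem _root_.AdmissibleWeight.integrableOn_pearson (hp : AdmissibleWeight I p) (q τ : ℝ[X])
    (hw : w.HasTemperateGrowth) :
    IntegrableOn (fun x => p x * (q.eval x * iteratedDeriv 1 w x + τ.eval x * w x)) I :=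
  hp.integrableOn_mul (((hasTemperateGrowth_eval q).mul (hasTemperateGrowth_iteratedDeriv hw 1)).add
    ((hasTemperateGrowth_eval τ).mul hw))

theorem tendsto_mul_zero {l : Filter ℝ} {e : ℝ} (hw : w.HasTemperateGrowth) (hl : l ≤ 𝓝 e)
    (h : Tendsto (fun x => p x * q.eval x) l (𝓝 0)) :
    Tendsto (fun x => p x * (q.eval x * w x)) l (𝓝 0) := by
  simpa only [zero_mul, mul_assoc] using h.mul ((hw.1.continuous.tendsto e).mono_left hl)

theorem weakPearson_univ (h : IsPearsonWeight q τ univ p) (hp : AdmissibleWeight univ p) :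
    WeakPearson q τ univ p := fun w hw => by
  rw [setIntegral_univ]
  exact integral_eq_zero_of_hasDerivAt_of_integrable
    (fun x => h.hasDerivAt_mul hw x (mem_univ x))
    (integrableOn_univ.1 (hp.integrableOn_pearson q τ hw))
    (integrableOn_univ.1 (hp.integrableOn_mul_mul (hasTemperateGrowth_eval q) hw))

theorem weakPearson_Ioi (h : IsPearsonWeight q τ (Ioi 0) p) (hp : AdmissibleWeight (Ioi 0) p)
    (h0 : Tendsto (fun x => p x * q.eval x) (𝓝[>] 0) (𝓝 0)) :
    WeakPearson q τ (Ioi 0) p := fun w hw => by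
  have hderiv := h.hasDerivAt_mul hw
  have hint := hp.integrableOn_pearson q τ hw
  have hlim := tendsto_nhdsGT_of_Ioi countable_empty (HasDerivAt.continuousOn hderiv)
    (fun x hx => hderiv x hx.1) hint (tendsto_zero_of_hasDerivAt_of_integrableOn_Ioi hderiv hint
      (hp.integrableOn_mul_mul (hasTemperateGrowth_eval q) hw))
  exact neg_eq_zero.1 (tendsto_nhds_unique hlim (tendsto_mul_zero hw nhdsWithin_le_nhds h0))

theorem weakPearson_Ioo {a b : ℝ} (hab : a < b) (h : IsPearsonWeight q τ (Ioo a b) p)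
    (hp : AdmissibleWeight (Ioo a b) p) (ha : Tendsto (fun x => p x * q.eval x) (𝓝[>] a) (𝓝 0))
    (hb : Tendsto (fun x => p x * q.eval x) (𝓝[<] b) (𝓝 0)) :
    WeakPearson q τ (Ioo a b) p := fun w hw => by
  rw [← integral_Ioc_eq_integral_Ioo, ← intervalIntegral.integral_of_le hab.le,
    intervalIntegral.integral_eq_sub_of_hasDerivAt_of_tendsto hab (h.hasDerivAt_mul hw)
    ((intervalIntegrable_iff_integrableOn_Ioo_of_le hab.le).2 (hp.integrableOn_pearson q τ hw))
    (tendsto_mul_zero hw nhdsWithin_le_nhds ha) (tendsto_mul_zero hw nhdsWithin_le_nhds hb),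
    sub_zero]

end IsPearsonWeight

end Pearson

section QuadraticOp

variable {q τ : ℝ[X]}

theorem natDegree_derivative_le_of_le_succ {R : Type*} [Semiring R] {f : R[X]} {n : ℕ}
    (hf : f.natDegree ≤ n + 1) : (derivative f).natDegree ≤ n :=
  (natDegree_derivative_le f).trans (Nat.sub_le_of_le_add hf)

theorem natDegree_derivative_add_le (hq : q.natDegree ≤ 2) (hτ : τ.natDegree ≤ 1) :
    (derivative q + τ).natDegree ≤ 1 :=
  natDegree_add_le_of_degree_le (natDegree_derivative_le_of_le_succ hq) hτ

theorem natDegree_derivative_derivative_add_le (hq : q.natDegree ≤ 2) (hτ : τ.natDegree ≤ 1) :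
    (derivative (derivative q) + 2 * derivative τ).natDegree ≤ 0 :=
  natDegree_add_le_of_degree_le
    (natDegree_derivative_le_of_le_succ (natDegree_derivative_le_of_le_succ hq))
    (natDegree_mul_le_of_le (natDegree_ofNat 2).le (natDegree_derivative_le_of_le_succ hτ))

theorem isOrderFour_quadraticOp (hq0 : q ≠ 0) (hq : q.natDegree ≤ 2) (hτ : τ.natDegree ≤ 1)
    (c : ℝ) : (quadraticOp q τ c).IsOrderFour := by
  have hτ' := natDegree_derivative_le_of_le_succ hτ
  have hsum := natDegree_derivative_add_le hq hτ
  have hC : (C c).natDegree ≤ 0 := (natDegree_C c).le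
  refine ⟨pow_ne_zero 2 hq0, ?_, ?_, ?_, natDegree_pow_le_of_le 2 hq⟩ <;>
    simp only [quadraticOp, derivative_of_natDegree_zero (Nat.le_zero.1 hτ'), mul_zero, zero_add]
  · exact natDegree_add_le_of_degree_le (natDegree_mul_le_of_le hτ hτ')
      (natDegree_mul_le_of_le hC hτ)
  · exact natDegree_add_le_of_degree_le (natDegree_add_le_of_degree_le
      (natDegree_mul_le_of_le hq
        (natDegree_derivative_derivative_add_le hq hτ)) (natDegree_mul_le_of_le hτ hsum))
      (natDegree_mul_le_of_le hC hq)
  · exact natDegree_mul_le_of_le (natDegree_mul_le_of_le (natDegree_ofNat 2).le hq) hsum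

theorem diagonal_quadraticOp (hq : q.natDegree ≤ 2) (hτ : τ.natDegree ≤ 1) (c : ℝ) (n : ℕ) :
    (quadraticOp q τ c).diagonal n =
      (n * (q.coeff 2 * (n - 1) + τ.coeff 1)) ^ 2
        + c * (n * (q.coeff 2 * (n - 1) + τ.coeff 1)) := by
  have hτ' := natDegree_derivative_le_of_le_succ hτ
  have hsum := natDegree_derivative_add_le hq hτ
  have h4 : (quadraticOp q τ c).a₄.coeff 4 = q.coeff 2 ^ 2 := coeff_pow_of_natDegree_le hq
  have h3 : (quadraticOp q τ c).a₃.coeff 3 = 2 * q.coeff 2 * (q.coeff 2 * 2 + τ.coeff 1) := by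
    rw [quadraticOp, coeff_mul_add_eq_of_natDegree_le (natDegree_mul_le_of_le
      (natDegree_ofNat 2).le hq) hsum]
    simp [coeff_derivative, one_add_one_eq_two]
  have h2 : (quadraticOp q τ c).a₂.coeff 2 = q.coeff 2 * (q.coeff 2 * 2 + 2 * τ.coeff 1)
      + τ.coeff 1 * (q.coeff 2 * 2 + τ.coeff 1) + c * q.coeff 2 := by
    rw [quadraticOp, coeff_add, coeff_add, coeff_mul_add_eq_of_natDegree_le hq
      (natDegree_derivative_derivative_add_le hq hτ),
      coeff_mul_add_eq_of_natDegree_le hτ hsum, coeff_C_mul]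
    simp [coeff_derivative, one_add_one_eq_two]
  have h1 : (quadraticOp q τ c).a₁.coeff 1 = τ.coeff 1 * τ.coeff 1 + c * τ.coeff 1 := by
    rw [quadraticOp, derivative_of_natDegree_zero (Nat.le_zero.1 hτ'), mul_zero, zero_add,
      coeff_add, coeff_mul_add_eq_of_natDegree_le hτ hτ', coeff_C_mul]
    simp [coeff_derivative]
  rw [DiffOp4.diagonal_eq, h4, h3, h2, h1]
  ring

end QuadraticOp

namespace IsPearsonWeight

variable {q τ : ℝ[X]} {I : Set ℝ} {p : ℝ → ℝ}

theorem selfAdjointWith (h : IsPearsonWeight q τ I p) (hw : WeakPearson q τ I p)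
    (hp : AdmissibleWeight I p) (hq : q.natDegree ≤ 2) (hτ : τ.natDegree ≤ 1) (hI : IsOpen I)
    (hconn : I.OrdConnected) (hne : I.Nonempty) (c : ℝ) :
    (quadraticOp q τ c).SelfAdjointWith {f | Function.HasTemperateGrowth f} I p where
  order_four := by
    obtain ⟨x, hx⟩ := hne
    refine isOrderFour_quadraticOp ?_ hq hτ c
    rintro rfl
    simpa using h.pos_mul x hx
  isOpen := hI
  ordConnected := hconn
  nonempty := hne
  weight := h.isWeight c
  admissible := hp
  symmetric := hw.symmetricOn hp c

end IsPearsonWeight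

theorem AdmissibleWeight.of_monomial {I : Set ℝ} {p : ℝ → ℝ}
    (h : ∀ n : ℕ, IntegrableOn (fun x => p x * x ^ n) I) : AdmissibleWeight I p := by
  intro q
  induction q using Polynomial.induction_on' with
  | add q r hq hr =>
    simp only [eval_add, mul_add]
    exact hq.add hr
  | monomial n a =>
    simp only [eval_monomial, mul_left_comm _ a]
    exact (h n).const_mul a

section Hermite

/-- The weight `exp (-m₂² x² + m₁ x)` of the Hermite family, normalized by `m₀ = 0`. -/
def hermiteWeight (m₁ m₂ x : ℝ) : ℝ :=
  Real.exp (-m₂ ^ 2 * x ^ 2 + m₁ * x)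

theorem hermiteOp_eq (m₁ m₂ A : ℝ) : hermiteOp m₁ m₂ A =
    quadraticOp 1 (C m₁ - C (2 * m₂ ^ 2) * X) (A - m₁ ^ 2 + 4 * m₂ ^ 2) := by
  ext1 <;> refine Polynomial.funext fun x => ?_ <;>
    simp [hermiteOp, quadraticOp, derivative_pow] <;> ring

theorem isPearsonWeight_hermite (m₁ m₂ : ℝ) (I : Set ℝ) :
    IsPearsonWeight 1 (C m₁ - C (2 * m₂ ^ 2) * X) I (hermiteWeight m₁ m₂) where
  pos x _ := Real.exp_pos _
  pos_mul x _ := by simpa using! Real.exp_pos _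
  hasDerivAt x _ := by
    have hexp := (((hasDerivAt_pow 2 x).const_mul (-m₂ ^ 2)).add
      ((hasDerivAt_id x).const_mul m₁)).exp
    simp only [eval_one, mul_one]
    refine hexp.congr_deriv ?_
    simp [hermiteWeight]
    ring

theorem admissibleWeight_hermite {m₁ m₂ : ℝ} (hm : m₂ ≠ 0) :
    AdmissibleWeight univ (hermiteWeight m₁ m₂) := by
  refine AdmissibleWeight.of_monomial fun n => ?_
  rw [integrableOn_univ]
  have hgauss := (integrable_rpow_mul_exp_neg_mul_sq (b := m₂ ^ 2 / 2) (s := n) (by positivity)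
    (by linarith [(n.cast_nonneg : (0 : ℝ) ≤ n)])).const_mul (Real.exp (m₁ ^ 2 / (2 * m₂ ^ 2)))
  refine hgauss.mono (by unfold hermiteWeight; fun_prop) (ae_of_all _ fun x => ?_)
  have hsquare : m₁ ^ 2 / (2 * m₂ ^ 2) + -(m₂ ^ 2 / 2) * x ^ 2 - (-m₂ ^ 2 * x ^ 2 + m₁ * x)
      = (m₂ ^ 2 * x - m₁) ^ 2 / (2 * m₂ ^ 2) := by
    field_simp
    ring
  have hnonneg : 0 ≤ (m₂ ^ 2 * x - m₁) ^ 2 / (2 * m₂ ^ 2) := by positivity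
  rw [Real.rpow_natCast, mul_left_comm, ← Real.exp_add, mul_comm, norm_mul, norm_mul,
    hermiteWeight, Real.norm_eq_abs (Real.exp _), Real.norm_eq_abs (Real.exp _), Real.abs_exp,
    Real.abs_exp]
  refine mul_le_mul_of_nonneg_left (Real.exp_le_exp.2 ?_) (norm_nonneg _)
  linarith

theorem selfAdjointWith_hermiteOp {m₁ m₂ : ℝ} (A : ℝ) (hm : m₂ ≠ 0) :
    (hermiteOp m₁ m₂ A).SelfAdjointWith {f | Function.HasTemperateGrowth f} univ
      (hermiteWeight m₁ m₂) := by
  have hpearson := isPearsonWeight_hermite m₁ m₂ univ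
  have hp := admissibleWeight_hermite (m₁ := m₁) hm
  rw [hermiteOp_eq]
  exact hpearson.selfAdjointWith (hpearson.weakPearson_univ hp) hp (by simp) (by compute_degree)
    isOpen_univ ordConnected_univ univ_nonempty _

end Hermite

section Laguerre

/-- The weight of the Laguerre family. -/
def laguerreWeight (a b y : ℝ) : ℝ :=
  |y| ^ (a / 2 - 2) * Real.exp (b / 2 * y)

theorem laguerreOp_eq (a b A : ℝ) : laguerreOp a b A =
    quadraticOp X (C ((a - 2) / 2) + C (b / 2) * X) (A - a * b / 2 - b / 2) := by
  ext1 <;> refine Polynomial.funext fun x => ?_ <;> simp [laguerreOp, quadraticOp] <;> ring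

theorem laguerreWeight_mul_self {a b y : ℝ} (hy : 0 < y) :
    laguerreWeight a b y * y = y ^ (a / 2 - 1) * Real.exp (b / 2 * y) := by
  rw [laguerreWeight, abs_of_pos hy, show a / 2 - 1 = a / 2 - 2 + 1 by ring,
    Real.rpow_add_one hy.ne']
  ring

theorem isPearsonWeight_laguerre (a b : ℝ) :
    IsPearsonWeight X (C ((a - 2) / 2) + C (b / 2) * X) (Ioi 0) (laguerreWeight a b) where
  pos y hy := mul_pos (Real.rpow_pos_of_pos (abs_pos.2 hy.out.ne') _) (Real.exp_pos _)
  pos_mul y hy := by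
    rw [eval_X, laguerreWeight_mul_self hy]
    exact mul_pos (Real.rpow_pos_of_pos hy _) (Real.exp_pos _)
  hasDerivAt y hy := by
    have hy0 : 0 < y := hy
    have hprod := (Real.hasDerivAt_rpow_const (p := a / 2 - 1) (Or.inl hy0.ne')).mul
      ((hasDerivAt_id y).const_mul (b / 2)).exp
    refine (hprod.congr_of_eventuallyEq ?_).congr_deriv ?_
    · filter_upwards [Ioi_mem_nhds hy0] with x hx
      rw [eval_X, laguerreWeight_mul_self hx]
      rfl
    · rw [laguerreWeight, abs_of_pos hy0, Real.rpow_sub_one hy0.ne',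
        show a / 2 - 2 = a / 2 - 1 - 1 by ring, Real.rpow_sub_one hy0.ne' (a / 2 - 1),
        Real.rpow_sub_one hy0.ne']
      simp
      field_simp

theorem admissibleWeight_laguerre_iff {a b : ℝ} (hb : b < 0) :
    AdmissibleWeight (Ioi 0) (laguerreWeight a b) ↔ 2 < a := by
  constructor
  · intro h
    have hint : IntegrableOn (fun y => laguerreWeight a b y * Real.exp (-b / 2 * y)) (Icc 0 1) := by
      refine IntegrableOn.mul_continuousOn ?_ (by fun_prop) isCompact_Icc
      refine (integrableOn_Icc_iff_integrableOn_Ioo (by finiteness) (by finiteness)).2 ?_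
      simpa using (h 1).mono_set Ioo_subset_Ioi_self
    have hpow : IntegrableOn (fun y : ℝ => y ^ (a / 2 - 2)) (Ioo 0 1) := by
      refine (hint.mono_set Ioo_subset_Icc_self).congr_fun (fun y hy => ?_) measurableSet_Ioo
      beta_reduce
      rw [laguerreWeight, abs_of_pos hy.1, mul_assoc, ← Real.exp_add, neg_div, neg_mul,
        add_neg_cancel, Real.exp_zero, mul_one]
    linarith [(intervalIntegral.integrableOn_Ioo_rpow_iff one_pos).1 hpow]
  · intro ha
    refine AdmissibleWeight.of_monomial fun n => ?_
    have hgamma := integrableOn_rpow_mul_exp_neg_mul_rpow (p := 1) (s := a / 2 - 2 + n)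
      (b := -b / 2) (by linarith [(n.cast_nonneg : (0 : ℝ) ≤ n)]) one_pos (by linarith)
    refine hgamma.congr_fun (fun x hx => ?_) measurableSet_Ioi
    have hx0 : 0 < x := hx
    beta_reduce
    rw [laguerreWeight, abs_of_pos hx0, Real.rpow_one, Real.rpow_add hx0, Real.rpow_natCast,
      show -(-b / 2) * x = b / 2 * x by ring]
    ring

theorem selfAdjointWith_laguerreOp {a b : ℝ} (A : ℝ) (ha : 2 < a) (hb : b < 0) :
    (laguerreOp a b A).SelfAdjointWith {f | Function.HasTemperateGrowth f} (Ioi 0)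
      (laguerreWeight a b) := by
  have hpearson := isPearsonWeight_laguerre a b
  have hp := (admissibleWeight_laguerre_iff hb).2 ha
  have hlim : Tendsto (fun y => laguerreWeight a b y * (X : ℝ[X]).eval y) (𝓝[>] 0) (𝓝 0) := by
    have hexp : 0 < a / 2 - 1 := by linarith
    have hcont : ContinuousAt (fun y : ℝ => y ^ (a / 2 - 1) * Real.exp (b / 2 * y)) 0 :=
      (Real.continuousAt_rpow_const 0 _ (Or.inr hexp.le)).mul (by fun_prop)
    have hzero := hcont.tendsto
    rw [Real.zero_rpow hexp.ne', zero_mul] at hzero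
    refine (hzero.mono_left nhdsWithin_le_nhds).congr' ?_
    filter_upwards [self_mem_nhdsWithin] with y hy
    rw [eval_X, laguerreWeight_mul_self hy]
  rw [laguerreOp_eq]
  exact hpearson.selfAdjointWith (hpearson.weakPearson_Ioi hp hlim) hp (by simp)
    (by compute_degree) isOpen_Ioi ordConnected_Ioi nonempty_Ioi _

end Laguerre

section Jacobi

/-- The Jacobi weight in the parametrization of the classification: the exponents `α` of `1 - y` and
`β` of `1 + y` are given by `α + β = -2 - a` and `β - α = b`. -/
def jacobiWeight (a b y : ℝ) : ℝ :=
  (1 - y) ^ ((-2 - a - b) / 2) * (1 + y) ^ ((-2 - a + b) / 2)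

theorem jacobiOp_eq {b : ℝ} (hb : b ≠ 0) (a B : ℝ) :
    jacobiOp a b B = quadraticOp (1 - X ^ 2) (C b + C a * X) (B / b - a) := by
  ext1 <;> refine Polynomial.funext fun x => ?_ <;> simp [jacobiOp, quadraticOp] <;>
    field_simp <;> ring

theorem gegenbauerOp_eq (a A : ℝ) : gegenbauerOp a A =
    quadraticOp (1 - X ^ 2) (C 0 + C a * X) (2 - 4 * a + a ^ 2 - A) := by
  ext1 <;> refine Polynomial.funext fun x => ?_ <;> simp [gegenbauerOp, quadraticOp] <;> ring

theorem jacobiWeight_zero_right (a : ℝ) {y : ℝ} (hy : y ∈ Ioo (-1 : ℝ) 1) :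
    jacobiWeight a 0 y = (1 - y ^ 2) ^ (-1 - a / 2) := by
  rw [jacobiWeight, sub_zero, add_zero, ← Real.mul_rpow (sub_pos.2 hy.2).le
    (neg_lt_iff_pos_add'.1 hy.1).le]
  congr 1 <;> ring

theorem jacobiWeight_neg (a b y : ℝ) : jacobiWeight a b (-y) = jacobiWeight a (-b) y := by
  rw [jacobiWeight, jacobiWeight, sub_neg_eq_add, sub_neg_eq_add, ← sub_eq_add_neg,
    ← sub_eq_add_neg, mul_comm]

theorem jacobiWeight_mul_eval (a b : ℝ) {y : ℝ} (hy : y ∈ Ioo (-1 : ℝ) 1) :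
    jacobiWeight a b y * (1 - X ^ 2 : ℝ[X]).eval y =
      (1 - y) ^ ((-a - b) / 2) * (1 + y) ^ ((-a + b) / 2) := by
  have hsub : 0 < 1 - y := sub_pos.2 hy.2
  have hadd : 0 < 1 + y := neg_lt_iff_pos_add'.1 hy.1
  rw [jacobiWeight, show (-a - b) / 2 = (-2 - a - b) / 2 + 1 by ring,
    show (-a + b) / 2 = (-2 - a + b) / 2 + 1 by ring, Real.rpow_add_one hsub.ne',
    Real.rpow_add_one hadd.ne']
  simp only [eval_sub, eval_one, eval_pow, eval_X]
  ring

theorem isPearsonWeight_jacobi (a b : ℝ) :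
    IsPearsonWeight (1 - X ^ 2) (C b + C a * X) (Ioo (-1) 1) (jacobiWeight a b) where
  pos y hy := mul_pos (Real.rpow_pos_of_pos (sub_pos.2 hy.2) _)
    (Real.rpow_pos_of_pos (neg_lt_iff_pos_add'.1 hy.1) _)
  pos_mul y hy := by
    rw [jacobiWeight_mul_eval a b hy]
    exact mul_pos (Real.rpow_pos_of_pos (sub_pos.2 hy.2) _)
      (Real.rpow_pos_of_pos (neg_lt_iff_pos_add'.1 hy.1) _)
  hasDerivAt y hy := by
    have hsub : 0 < 1 - y := sub_pos.2 hy.2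
    have hadd : 0 < 1 + y := neg_lt_iff_pos_add'.1 hy.1
    have hprod := (((hasDerivAt_id y).const_sub 1).rpow_const (p := (-a - b) / 2)
      (Or.inl hsub.ne')).mul (((hasDerivAt_id y).const_add 1).rpow_const (p := (-a + b) / 2)
      (Or.inl hadd.ne'))
    refine (hprod.congr_of_eventuallyEq ?_).congr_deriv ?_
    · filter_upwards [isOpen_Ioo.mem_nhds hy] with x hx
      exact jacobiWeight_mul_eval a b hx
    · rw [jacobiWeight, show (-2 - a - b) / 2 = (-a - b) / 2 - 1 by ring,
        show (-2 - a + b) / 2 = (-a + b) / 2 - 1 by ring]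
      simp only [id, Real.rpow_sub_one hsub.ne', Real.rpow_sub_one hadd.ne', eval_add, eval_mul,
        eval_C, eval_X]
      field_simp
      ring

theorem integrableOn_Ioo_one_add_rpow_iff {s : ℝ} :
    IntegrableOn (fun y : ℝ => (1 + y) ^ s) (Ioo (-1) 0) ↔ -1 < s := by
  have hshift := (measurePreserving_add_left volume (1 : ℝ)).integrableOn_comp_preimage
    (measurableEmbedding_addLeft 1) (f := fun x : ℝ => x ^ s) (s := Ioo 0 1)
  rwa [preimage_const_add_Ioo, zero_sub, sub_self,
    intervalIntegral.integrableOn_Ioo_rpow_iff one_pos] at hshift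

theorem integrableOn_jacobiWeight_left_iff {a b : ℝ} :
    IntegrableOn (jacobiWeight a b) (Ioo (-1) 0) ↔ 0 < b - a := by
  have hcont (s : ℝ) : ContinuousOn (fun y : ℝ => (1 - y) ^ s) (Icc (-1) 0) :=
    ContinuousOn.rpow_const (by fun_prop) fun y hy => Or.inl (by linarith [hy.2])
  have hIcc (f : ℝ → ℝ) : IntegrableOn f (Icc (-1) 0) ↔ IntegrableOn f (Ioo (-1) 0) :=
    integrableOn_Icc_iff_integrableOn_Ioo (by finiteness) (by finiteness)
  have hiff : IntegrableOn (jacobiWeight a b) (Ioo (-1) 0) ↔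
      IntegrableOn (fun y : ℝ => (1 + y) ^ ((-2 - a + b) / 2)) (Ioo (-1) 0) := by
    refine ⟨fun h => ?_, fun h => ?_⟩
    · refine (((hIcc _).2 h).continuousOn_mul (hcont (-((-2 - a - b) / 2)))
        isCompact_Icc).mono_set Ioo_subset_Icc_self |>.congr_fun (fun y hy => ?_) measurableSet_Ioo
      have hsub : 0 < 1 - y := by linarith [hy.2]
      beta_reduce
      rw [jacobiWeight, ← mul_assoc, ← Real.rpow_add hsub, neg_add_cancel, Real.rpow_zero, one_mul]
    · exact (((hIcc _).2 h).continuousOn_mul (hcont _) isCompact_Icc).mono_set Ioo_subset_Icc_self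
  rw [hiff, integrableOn_Ioo_one_add_rpow_iff]
  constructor <;> intro h <;> linarith

theorem integrableOn_jacobiWeight_right_iff {a b : ℝ} :
    IntegrableOn (jacobiWeight a b) (Ioo 0 1) ↔ b + a < 0 := by
  rw [← (Measure.measurePreserving_neg volume).integrableOn_comp_preimage
    (Homeomorph.neg ℝ).measurableEmbedding]
  simp only [neg_preimage, neg_Ioo, neg_zero, Function.comp_def, jacobiWeight_neg]
  rw [integrableOn_jacobiWeight_left_iff]
  constructor <;> intro h <;> linarith

theorem admissibleWeight_jacobi_iff {a b : ℝ} :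
    AdmissibleWeight (Ioo (-1) 1) (jacobiWeight a b) ↔ 0 < b - a ∧ b + a < 0 := by
  rw [← integrableOn_jacobiWeight_left_iff, ← integrableOn_jacobiWeight_right_iff]
  constructor
  · intro h
    have hint : IntegrableOn (jacobiWeight a b) (Ioo (-1) 1) := by simpa using h 1
    exact ⟨hint.mono_set (Ioo_subset_Ioo_right zero_le_one),
      hint.mono_set (Ioo_subset_Ioo_left (by norm_num))⟩
  · rintro ⟨hleft, hright⟩ q
    have hint : IntegrableOn (jacobiWeight a b) (Icc (-1) 1) := by
      rw [← Icc_union_Icc_eq_Icc (b := (0 : ℝ)) (by norm_num) (by norm_num)]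
      exact ((integrableOn_Icc_iff_integrableOn_Ioo (by finiteness) (by finiteness)).2 hleft).union
        ((integrableOn_Icc_iff_integrableOn_Ioo (by finiteness) (by finiteness)).2 hright)
    exact (hint.mul_continuousOn q.continuous.continuousOn isCompact_Icc).mono_set
      Ioo_subset_Icc_self

theorem tendsto_jacobiWeight_mul_eval {a b : ℝ} (hleft : 0 < b - a) (hright : b + a < 0) {e : ℝ}
    {l : Filter ℝ} (he : e ^ 2 = 1) (hl : l ≤ 𝓝 e) (hmem : Ioo (-1) 1 ∈ l) :
    Tendsto (fun y => jacobiWeight a b y * (1 - X ^ 2 : ℝ[X]).eval y) l (𝓝 0) := by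
  have hcont : Continuous fun y : ℝ => (1 - y) ^ ((-a - b) / 2) * (1 + y) ^ ((-a + b) / 2) :=
    ((continuous_const.sub continuous_id).rpow_const fun _ => Or.inr (by linarith)).mul
      ((continuous_const.add continuous_id).rpow_const fun _ => Or.inr (by linarith))
  have hzero : (1 - e) ^ ((-a - b) / 2) * (1 + e) ^ ((-a + b) / 2) = 0 := by
    rcases sq_eq_one_iff.1 he with rfl | rfl
    · rw [sub_self, Real.zero_rpow (by linarith), zero_mul]
    · rw [add_neg_cancel, Real.zero_rpow (by linarith), mul_zero]
  refine ((hzero ▸ hcont.tendsto e).mono_left hl).congr' ?_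
  filter_upwards [hmem] with y hy
  rw [jacobiWeight_mul_eval a b hy]

theorem selfAdjointWith_quadraticOp_jacobi {a b : ℝ} (hleft : 0 < b - a) (hright : b + a < 0)
    (c : ℝ) : (quadraticOp (1 - X ^ 2) (C b + C a * X) c).SelfAdjointWith
      {f | Function.HasTemperateGrowth f} (Ioo (-1) 1) (jacobiWeight a b) := by
  have hpearson := isPearsonWeight_jacobi a b
  have hp := admissibleWeight_jacobi_iff.2 ⟨hleft, hright⟩
  have hlt : (-1 : ℝ) < 1 := by norm_num
  have hweak := hpearson.weakPearson_Ioo hlt hp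
    (tendsto_jacobiWeight_mul_eval hleft hright (by norm_num) nhdsWithin_le_nhds
      (Ioo_mem_nhdsGT hlt))
    (tendsto_jacobiWeight_mul_eval hleft hright (by norm_num) nhdsWithin_le_nhds
      (Ioo_mem_nhdsLT hlt))
  exact hpearson.selfAdjointWith hweak hp (by compute_degree) (by compute_degree)
    isOpen_Ioo ordConnected_Ioo (nonempty_Ioo.2 hlt) _

end Jacobi

section Eigenvalues

theorem DiffOp4.SelfAdjointWith.hasEigenvalues_of_hasTemperateGrowth {L : DiffOp4} {I : Set ℝ}
    {p : ℝ → ℝ} (H : L.SelfAdjointWith {f | Function.HasTemperateGrowth f} I p) :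
    L.HasEigenvalues L.diagonal := by
  refine SelfAdjointWith.hasEigenvalues (H.mono ?_)
  rintro _ ⟨q, rfl⟩
  exact hasTemperateGrowth_eval q

theorem hasEigenvalues_hermiteOp {m₂ : ℝ} (m₁ A : ℝ) (hm : m₂ ≠ 0) :
    (hermiteOp m₁ m₂ A).HasEigenvalues
      (fun n => 2 * m₂ ^ 2 * (m₁ ^ 2 - A + 2 * m₂ ^ 2 * ((n : ℝ) - 2)) * n) := by
  convert (selfAdjointWith_hermiteOp A hm).hasEigenvalues_of_hasTemperateGrowth using 2 with n
  rw [hermiteOp_eq, diagonal_quadraticOp (by simp) (by compute_degree)]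
  simp [coeff_one, -map_mul, -map_pow]
  ring

theorem hasEigenvalues_laguerreOp {a b : ℝ} (A : ℝ) (ha : 2 < a) (hb : b < 0) :
    (laguerreOp a b A).HasEigenvalues
      (fun n => b / 4 * n * (2 * A - a * b - b + b * n)) := by
  convert (selfAdjointWith_laguerreOp A ha hb).hasEigenvalues_of_hasTemperateGrowth using 2 with n
  rw [laguerreOp_eq, diagonal_quadraticOp (by simp) (by compute_degree)]
  simp [coeff_X]
  ring

theorem diagonal_quadraticOp_jacobi (a b c : ℝ) (n : ℕ) :
    (quadraticOp (1 - X ^ 2) (C b + C a * X) c).diagonal n =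
      n * (a - n + 1) * (n * (a - n + 1) + c) := by
  rw [diagonal_quadraticOp (by compute_degree) (by compute_degree)]
  simp [coeff_one]
  ring

theorem hasEigenvalues_gegenbauerOp {a : ℝ} (A : ℝ) (ha : a < 0) :
    (gegenbauerOp a A).HasEigenvalues
      (fun n => n * (-a + n - 1) * (-a ^ 2 - n * a + 4 * a + (n : ℝ) ^ 2 + A - n - 2)) := by
  rw [gegenbauerOp_eq]
  convert (selfAdjointWith_quadraticOp_jacobi (by rwa [zero_sub, neg_pos]) (by rwa [zero_add])
    _).hasEigenvalues_of_hasTemperateGrowth using 2 with n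
  rw [diagonal_quadraticOp_jacobi]
  ring

theorem hasEigenvalues_jacobiOp {a b : ℝ} (B : ℝ) (hb : b ≠ 0) (hleft : 0 < b - a)
    (hright : b + a < 0) : (jacobiOp a b B).HasEigenvalues
      (fun n => (a - n + 1) * n * (-b * (n : ℝ) ^ 2 + a * b * n + b * n - a * b + B) / b) := by
  rw [jacobiOp_eq hb]
  convert (selfAdjointWith_quadraticOp_jacobi hleft hright
    _).hasEigenvalues_of_hasTemperateGrowth using 2 with n
  rw [diagonal_quadraticOp_jacobi]
  field_simp
  ring

end Eigenvalues

theorem exists_eq_Ioi_or_Iio_or_Ioo_or_univ {α : Type*} [ConditionallyCompleteLinearOrder α]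
    [TopologicalSpace α] [OrderTopology α] [DenselyOrdered α] [NoMinOrder α] [NoMaxOrder α]
    {I : Set α} (hI : IsOpen I) (hc : IsConnected I) :
    I = univ ∨ (∃ d, I = Ioi d) ∨ (∃ e, I = Iio e) ∨ ∃ d e, I = Ioo d e := by
  have lower (h : BddBelow I) : I ⊆ Ioi (sInf I) := by
    rw [← interior_Ici]
    exact interior_maximal (fun x hx => csInf_le h hx) hI
  have upper (h : BddAbove I) : I ⊆ Iio (sSup I) := by
    rw [← interior_Iic]
    exact interior_maximal (fun x hx => le_csSup h hx) hI
  by_cases hb : BddBelow I <;> by_cases ha : BddAbove I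
  · exact .inr <| .inr <| .inr ⟨_, _, subset_antisymm (subset_inter (lower hb) (upper ha))
      (hc.Ioo_csInf_csSup_subset hb ha)⟩
  · exact .inr <| .inl ⟨_, subset_antisymm (lower hb) (hc.2.Ioi_csInf_subset hb ha)⟩
  · exact .inr <| .inr <| .inl ⟨_, subset_antisymm (upper ha) (hc.2.Iio_csSup_subset hb ha)⟩
  · exact .inl (hc.2.eq_univ_of_unbounded hb ha)

theorem pow_two_dvd_of_eval_eq_zero {K : Type*} [Field K] {f : K[X]} {t : K}
    (h : f.eval t = 0) (h' : (derivative f).eval t = 0) : (X - C t) ^ 2 ∣ f := by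
  rcases eq_or_ne f 0 with rfl | hf
  · exact dvd_zero _
  · exact (le_rootMultiplicity_iff hf).1 ((one_lt_rootMultiplicity_iff_isRoot hf).2 ⟨h, h'⟩)

theorem one_sub_X_sq_pow_dvd {K : Type*} [Field K] [NeZero (2 : K)] {f : K[X]} {n : ℕ}
    (h : ∀ e : K, e ^ 2 = 1 → (X - C e) ^ n ∣ f) : (1 - X ^ 2) ^ n ∣ f := by
  have hcop : IsCoprime ((X - C (1 : K)) ^ n) ((X - C (-1)) ^ n) :=
    (isCoprime_X_sub_C_of_isUnit_sub (by
      rw [sub_neg_eq_add, one_add_one_eq_two]; exact (NeZero.ne (2 : K)).isUnit)).pow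
  have hfactor : (1 - X ^ 2 : K[X]) = -((X - C 1) * (X - C (-1))) := by
    simp only [map_neg, map_one]
    ring
  rw [hfactor, neg_pow, mul_pow, IsUnit.mul_left_dvd (isUnit_one.neg.pow n)]
  exact hcop.mul_dvd (h 1 (one_pow 2)) (h (-1) (by norm_num))

theorem AdmissibleWeight.of_eq_mul {I : Set ℝ} {p w : ℝ → ℝ} {c : ℝ} (h : AdmissibleWeight I p)
    (hI : MeasurableSet I) (hc : c ≠ 0) (hp : ∀ x ∈ I, p x = c * w x) : AdmissibleWeight I w :=
  fun q => by
    refine IntegrableOn.congr_fun ((h q).const_mul c⁻¹) (fun x hx => ?_) hI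
    simp only [hp x hx, mul_assoc, inv_mul_cancel_left₀ hc]

namespace DiffOp4

variable {L : DiffOp4} {I : Set ℝ} {p w : ℝ → ℝ} {q τ : ℝ[X]} {r s κ c : ℝ}

theorem IsWeight.exists_eq_mul (hp : L.IsWeight I p) (hw : L.IsWeight I w) (hI : IsOpen I)
    (hconn : IsPreconnected I) (h4 : ∀ x ∈ I, L.a₄.eval x ≠ 0) :
    ∃ c > 0, ∀ x ∈ I, p x = c * w x := by
  obtain ⟨F, hF⟩ := hp
  obtain ⟨G, hG⟩ := hw
  have hderiv (x : ℝ) (hx : x ∈ I) : HasDerivAt (fun x => F x - G x) 0 x :=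
    ((hF x hx (h4 x hx)).1.sub (hG x hx (h4 x hx)).1).congr_deriv (sub_self _)
  obtain ⟨k, hk⟩ := hI.exists_is_const_of_deriv_eq_zero hconn
    (fun x hx => (hderiv x hx).differentiableAt.differentiableWithinAt)
    (fun x hx => (hderiv x hx).deriv)
  refine ⟨Real.exp (k / 2), Real.exp_pos _, fun x hx => ?_⟩
  rw [(hF x hx (h4 x hx)).2, (hG x hx (h4 x hx)).2, ← mul_div_assoc, ← Real.exp_add, ← hk x hx]
  ring_nf

theorem SelfAdjointWith.exists_eq_mul_of_isPearsonWeight {𝒟 : Set (ℝ → ℝ)}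
    (H : (quadraticOp q τ c).SelfAdjointWith 𝒟 I p) (hw : IsPearsonWeight q τ I w) :
    ∃ k > 0, (∀ x ∈ I, p x = k * w x) ∧ AdmissibleWeight I w := by
  obtain ⟨k, hk, hp⟩ := H.weight.exists_eq_mul (hw.isWeight c) H.isOpen
    H.ordConnected.isPreconnected fun x hx => by
      rw [quadraticOp, eval_pow]
      exact pow_ne_zero 2 (right_ne_zero_of_mul (hw.pos_mul x hx).ne')
  exact ⟨k, hk, hp, H.admissible.of_eq_mul H.isOpen.measurableSet hk.ne' hp⟩

section LeadingSquare

/-- The coefficients of order four and three of `L` are those of `T²`, where `T = q D² + τ D`. -/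
structure HasLeadingSquare (L : DiffOp4) (q τ : ℝ[X]) : Prop where
  a₄_eq : L.a₄ = q ^ 2
  a₃_eq : L.a₃ = 2 * q * (derivative q + τ)

/-- The function `g` for which `L u = ((p q² u'')'' + (p g u')') / p`, when `L` has the leading
terms of `T²`, `T = q D² + τ D`, and `(p q)' = p τ`. Thus `L = T² + c T` when `g = (c + τ') q`. -/
def residual (L : DiffOp4) (q τ : ℝ[X]) : ℝ[X] :=
  L.a₂ - q * derivative (derivative q + τ) - τ * (derivative q + τ)

theorem hasLeadingSquare_of_eq_mul {m : ℝ[X]} (h4 : L.a₄ = q ^ 2) (h3 : L.a₃ = q * m) :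
    L.HasLeadingSquare q (C (1 / 2) * m - derivative q) where
  a₄_eq := h4
  a₃_eq := by
    rw [h3, add_sub_cancel, ← map_ofNat (C : ℝ →+* ℝ[X]) 2]
    calc q * m = C (2 * (1 / 2)) * (q * m) := by norm_num
      _ = _ := by rw [C_mul]; ring

theorem natDegree_residual_le (h2 : L.a₂.natDegree ≤ 2) (hq : q.natDegree ≤ 2)
    (hτ : τ.natDegree ≤ 1) : (L.residual q τ).natDegree ≤ 2 := by
  have hsum := natDegree_derivative_add_le hq hτ
  exact (natDegree_sub_le _ _).trans <| max_le ((natDegree_sub_le _ _).trans <| max_le h2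
    (natDegree_mul_le_of_le hq (natDegree_derivative_le_of_le_succ hsum)))
    (natDegree_mul_le_of_le hτ hsum)

namespace HasLeadingSquare

variable (h : L.HasLeadingSquare q τ)
include h

theorem logDerivNum_eq : L.logDerivNum = 2 * q * (τ - derivative q) := by
  rw [logDerivNum, h.a₄_eq, h.a₃_eq, derivative_pow]
  simp only [Nat.cast_ofNat, map_ofNat]
  ring

theorem secondNum_eq : L.secondNum = 4 * q ^ 2 * L.residual q τ := by
  rw [secondNum, h.logDerivNum_eq, residual, h.a₄_eq, h.a₃_eq]
  simp only [derivative_mul, derivative_add, derivative_ofNat]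
  ring

theorem mul_a₁ (hL : L.IsFormallySymmetric) (hq : q ≠ 0) :
    q * L.a₁ = (τ - derivative q) * L.residual q τ + q * derivative (L.residual q τ) := by
  rw [IsFormallySymmetric, h.secondNum_eq, h.logDerivNum_eq, h.a₄_eq] at hL
  refine mul_left_cancel₀ (mul_ne_zero (C_ne_zero.2 (by norm_num : (8 : ℝ) ≠ 0))
    (pow_ne_zero 3 hq)) ?_
  simp only [derivative_mul, derivative_pow, derivative_ofNat, Nat.cast_ofNat, map_ofNat] at hL ⊢
  linear_combination hL

theorem a₁_eq (hL : L.IsFormallySymmetric) (hq : q ≠ 0) {g : ℝ[X]}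
    (hg : L.residual q τ = q * g) : L.a₁ = τ * g + q * derivative g := by
  refine mul_left_cancel₀ hq ?_
  rw [h.mul_a₁ hL hq, hg, derivative_mul]
  ring

theorem eq_quadraticOp (hL : L.IsFormallySymmetric) (hq : q ≠ 0) (hτ : τ.natDegree ≤ 1) {k : ℝ}
    (hg : L.residual q τ = q * C k) : L = quadraticOp q τ (k - τ.coeff 1) := by
  have hτ' : derivative τ = C (τ.coeff 1) := by
    rw [eq_C_of_natDegree_le_zero (natDegree_derivative_le_of_le_succ hτ), coeff_derivative]
    simp
  have h1 := h.a₁_eq hL hq hg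
  rw [residual, derivative_add, hτ'] at hg
  ext1
  · simp only [quadraticOp, h1, hτ', derivative_C, map_sub]
    ring
  · simp only [quadraticOp, hτ', map_sub]
    linear_combination hg
  · exact h.a₃_eq
  · exact h.a₄_eq

theorem exists_eq_quadraticOp_of_natDegree_le_one (hL : L.IsFormallySymmetric)
    (h1 : L.a₁.natDegree ≤ 1) (hq0 : q ≠ 0) (hq : q.natDegree ≤ 1) (hτ : τ.natDegree = 1)
    (hdvd : q ∣ L.residual q τ) : ∃ c, L = quadraticOp q τ c := by
  obtain ⟨g, hg⟩ := hdvd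
  suffices hg0 : g.natDegree = 0 by
    rw [eq_C_of_natDegree_eq_zero hg0] at hg
    exact ⟨_, h.eq_quadraticOp hL hq0 hτ.le hg⟩
  by_contra hg0
  have hlt : (q * derivative g).natDegree < (τ * g).natDegree := by
    rw [natDegree_mul (ne_zero_of_natDegree_gt (hτ.symm ▸ one_pos))
      (ne_zero_of_natDegree_gt (Nat.pos_of_ne_zero hg0)), hτ]
    have hmul := natDegree_mul_le (p := q) (q := derivative g)
    have hder := natDegree_derivative_le g
    lia
  rw [h.a₁_eq hL hq0 hg, natDegree_add_eq_left_of_natDegree_lt hlt,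
    natDegree_mul (ne_zero_of_natDegree_gt (hτ.symm ▸ one_pos))
      (ne_zero_of_natDegree_gt (Nat.pos_of_ne_zero hg0))] at h1
  lia

theorem exists_eq_quadraticOp_of_natDegree_eq_two (hL : L.IsFormallySymmetric)
    (h2 : L.a₂.natDegree ≤ 2) (hq : q.natDegree = 2) (hτ : τ.natDegree ≤ 1)
    (hdvd : q ∣ L.residual q τ) : ∃ c, L = quadraticOp q τ c := by
  have hq0 : q ≠ 0 := ne_zero_of_natDegree_gt (hq.symm ▸ two_pos)
  have hdeg := natDegree_residual_le h2 hq.le hτ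
  obtain ⟨g, hg⟩ := hdvd
  have hg0 : g.natDegree = 0 := by
    rcases eq_or_ne g 0 with rfl | hne
    · exact natDegree_zero
    · rw [hg, natDegree_mul hq0 hne, hq] at hdeg
      lia
  rw [eq_C_of_natDegree_eq_zero hg0] at hg
  exact ⟨_, h.eq_quadraticOp hL hq0 hτ hg⟩

theorem affine (hr : r ≠ 0) (s : ℝ) : (L.affine r s).HasLeadingSquare
    (C (r⁻¹ ^ 2) * q.comp (C r * X + C s)) (C r⁻¹ * τ.comp (C r * X + C s)) where
  a₄_eq := by
    simp only [DiffOp4.affine, h.a₄_eq, pow_comp, mul_pow, ← C_pow]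
    ring_nf
  a₃_eq := by
    refine Polynomial.funext fun x => ?_
    simp [DiffOp4.affine, h.a₃_eq, eval_comp, derivative_comp]
    field_simp

theorem natDegree_a₃ (h3 : L.a₃ ≠ 0) :
    L.a₃.natDegree = q.natDegree + (derivative q + τ).natDegree := by
  rw [h.a₃_eq] at h3 ⊢
  rw [natDegree_mul (left_ne_zero_of_mul h3) (right_ne_zero_of_mul h3),
    ← map_ofNat (C : ℝ →+* ℝ[X]) 2, natDegree_C_mul two_ne_zero]

theorem natDegree_le_one (hq : q.natDegree = 2) (h3 : L.a₃.natDegree ≤ 3) : τ.natDegree ≤ 1 := by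
  have hq0 : q ≠ 0 := ne_zero_of_natDegree_gt (hq.symm ▸ two_pos)
  have hsum : (derivative q + τ).natDegree ≤ 1 := by
    by_cases hσ : derivative q + τ = 0
    · rw [hσ, natDegree_zero]
      exact zero_le_one
    · have ha₃ : L.a₃ ≠ 0 := by
        rw [h.a₃_eq]
        exact mul_ne_zero (mul_ne_zero two_ne_zero hq0) hσ
      have hd := h.natDegree_a₃ ha₃
      lia
  rw [← add_sub_cancel_left (derivative q) τ]
  exact natDegree_sub_le_of_le hsum (natDegree_derivative_le_of_le_succ hq.le)

end HasLeadingSquare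

theorem residual_affine (hr : r ≠ 0) (s : ℝ) (L : DiffOp4) (q τ : ℝ[X]) :
    (L.affine r s).residual (C (r⁻¹ ^ 2) * q.comp (C r * X + C s))
      (C r⁻¹ * τ.comp (C r * X + C s)) =
      C (r⁻¹ ^ 2) * (L.residual q τ).comp (C r * X + C s) := by
  refine Polynomial.funext fun x => ?_
  simp [residual, affine, eval_comp, derivative_comp]
  field_simp

end LeadingSquare

namespace SelfAdjointWith

variable (H : L.SelfAdjointWith polyFunctions I p)
include H

theorem eval_residual_left_end (hI : StartsAtZero I) (h : L.HasLeadingSquare q τ)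
    (h0 : q.eval 0 = 0) (h1 : (derivative q).eval 0 ≠ 0) : (L.residual q τ).eval 0 = 0 := by
  have hq : q ≠ 0 := fun hq => h1 (by rw [hq, derivative_zero, eval_zero])
  by_contra hres
  have hτ : (τ - derivative q).eval 0 = 0 := by
    have hmul := congrArg (eval 0) (h.mul_a₁ H.isFormallySymmetric hq)
    simpa [h0, hres] using hmul
  obtain ⟨w, rfl⟩ : X ∣ q := X_dvd_iff.2 (by rwa [coeff_zero_eq_eval_zero])
  obtain ⟨v, hv⟩ : X ∣ τ - derivative (X * w) := X_dvd_iff.2 (by rwa [coeff_zero_eq_eval_zero])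
  have hw : (w ^ 2).eval 0 ≠ 0 := by simpa [derivative_mul] using h1
  have h2 := H.eval_a₂_left_end hI (r := w ^ 2) (u := 2 * w * v) (by rw [h.a₄_eq]; ring) hw
    (by rw [h.logDerivNum_eq, hv]; ring)
  refine hres ?_
  rw [h.a₃_eq] at h2
  simp only [derivative_mul, derivative_X, one_mul, derivative_ofNat, zero_mul, zero_add,
    derivative_add, eval_add, eval_mul, eval_ofNat, eval_X, add_zero, mul_zero] at h2
  simp only [derivative_mul, derivative_X, one_mul, eval_sub, eval_add, eval_mul, eval_X, zero_mul,
    add_zero] at hτ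
  simp only [residual, derivative_mul, derivative_X, one_mul, derivative_add, eval_sub, eval_mul,
    eval_X, zero_mul, eval_add, add_zero, sub_zero]
  linear_combination h2 / 2 - (τ.eval 0 + w.eval 0) * hτ

theorem affine (hr : r ≠ 0) (s : ℝ) :
    (L.affine r s).SelfAdjointWith polyFunctions {y | r * y + s ∈ I} (fun y => p (r * y + s)) := by
  simpa only [scale_one, one_mul] using
    H.affine_scale isTestSpace_polyFunctions hr one_ne_zero one_pos s

theorem scale (hκ : κ ≠ 0) : (L.scale κ).SelfAdjointWith polyFunctions I p := by
  simpa [affine_one_zero, ofPred_mem_eq] using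
    H.affine_scale isTestSpace_polyFunctions one_ne_zero hκ one_pos 0

theorem eval_a₄_end (hr : r ≠ 0) (hI : StartsAtZero {y | r * y + s ∈ I}) : L.a₄.eval s = 0 := by
  simpa [DiffOp4.affine, eval_comp, hr] using (H.affine hr s).eval_a₄_left_end hI

theorem eval_derivative_a₄_end (hr : r ≠ 0) (hI : StartsAtZero {y | r * y + s ∈ I}) :
    (derivative L.a₄).eval s = 0 := by
  simpa [DiffOp4.affine, eval_comp, derivative_comp, hr] using
    (H.affine hr s).eval_derivative_a₄_left_end hI

theorem eval_residual_end (hr : r ≠ 0) (hI : StartsAtZero {y | r * y + s ∈ I})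
    (h : L.HasLeadingSquare q τ) (h0 : q.eval s = 0) (h1 : (derivative q).eval s ≠ 0) :
    (L.residual q τ).eval s = 0 := by
  have hres := (H.affine hr s).eval_residual_left_end hI (h.affine hr s)
    (by simp [eval_comp, h0]) (by simp [eval_comp, derivative_comp, hr, h1])
  rw [residual_affine hr] at hres
  simpa [eval_comp, hr] using hres

end SelfAdjointWith

theorem IsFormallySymmetric.eval_a₃_eq_zero (h : L.IsFormallySymmetric) {x : ℝ}
    (h4 : L.a₄.eval x = 0) (h4' : (derivative L.a₄).eval x = 0) : L.a₃.eval x = 0 := by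
  have hx := congrArg (eval x) h
  simp only [secondNum, logDerivNum, eval_mul, eval_add, eval_sub, eval_pow, eval_ofNat, h4,
    h4'] at hx
  refine pow_eq_zero_iff three_ne_zero |>.1 ?_
  linear_combination hx

end DiffOp4

theorem startsAtZero_setOf_mem_Ioo {e : ℝ} (he : e ^ 2 = 1) :
    StartsAtZero {y | -e * y + e ∈ Ioo (-1) 1} := by
  refine .inr ⟨2, two_pos, ?_⟩
  ext y
  rcases sq_eq_one_iff.1 he with rfl | rfl <;> simp only [mem_ofPred_eq, mem_Ioo] <;>
    constructor <;> rintro ⟨_, _⟩ <;> constructor <;> linarith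

namespace DiffOp4

variable {L : DiffOp4} {I : Set ℝ} {p : ℝ → ℝ} {q τ : ℝ[X]} {x₀ : ℝ}

theorem exists_hasLeadingSquare_scale (h4 : L.a₄ ≠ 0) (hq : (q ^ 2).Monic) (hdvd : q ^ 2 ∣ L.a₄)
    (hdeg : L.a₄.natDegree ≤ (q ^ 2).natDegree) (h3 : q ∣ L.a₃) :
    ∃ κ ≠ 0, ∃ τ, (L.scale κ).HasLeadingSquare q τ := by
  obtain ⟨m, hm⟩ := h3
  have hk := leadingCoeff_ne_zero.2 h4
  refine ⟨L.a₄.leadingCoeff⁻¹, inv_ne_zero hk, _,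
    hasLeadingSquare_of_eq_mul (m := C L.a₄.leadingCoeff⁻¹ * m) ?_ ?_⟩
  · rw [scale, eq_leadingCoeff_mul_of_monic_of_dvd_of_natDegree_le hq hdvd hdeg, ← mul_assoc,
      leadingCoeff_mul_monic hq, leadingCoeff_C, ← C_mul, inv_mul_cancel₀ hk, C_1, one_mul]
  · rw [scale, hm]
    ring

namespace SelfAdjointWith

theorem exists_eq_quadraticOp_of_Ioi_subset (H : L.SelfAdjointWith polyFunctions I p)
    (hI : Ioi x₀ ⊆ I) (h : L.HasLeadingSquare q τ) (hq : q.Monic) (hq1 : q.natDegree ≤ 1)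
    (hd : L.a₃.natDegree = q.natDegree + 1) (hdvd : q ∣ L.residual q τ) :
    ∃ t₀ t₁ c, t₁ < 0 ∧ L = quadraticOp q (C t₀ + C t₁ * X) c := by
  have hneg := H.leadingCoeff_mul_neg_of_Ioi_subset hI
  have hq' : (derivative q).natDegree = 0 :=
    Nat.le_zero.1 (natDegree_derivative_le_of_le_succ hq1)
  have hsum : (derivative q + τ).natDegree = 1 := by
    have hdeg := h.natDegree_a₃ (H.a₃_ne_zero_of_Ioi_subset hI)
    lia
  have hτ : τ.natDegree = 1 := by
    rwa [eq_C_of_natDegree_eq_zero hq', natDegree_C_add] at hsum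
  obtain ⟨c, hc⟩ := h.exists_eq_quadraticOp_of_natDegree_le_one H.isFormallySymmetric
    H.order_four.2.1 hq.ne_zero hq1 hτ hdvd
  have hτeq : τ = C (τ.coeff 0) + C (τ.coeff 1) * X := by
    rw [add_comm]
    exact eq_X_add_C_of_natDegree_le_one hτ.le
  refine ⟨τ.coeff 0, τ.coeff 1, c, ?_, by rwa [← hτeq]⟩
  rw [h.a₃_eq, h.a₄_eq, (hq.pow 2).leadingCoeff, mul_one, mul_assoc, leadingCoeff_mul,
    leadingCoeff_mul, hq.leadingCoeff, one_mul, ← map_ofNat (C : ℝ →+* ℝ[X]) 2, leadingCoeff_C,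
    leadingCoeff, hsum, coeff_add, coeff_eq_zero_of_natDegree_lt (hq'.trans_lt one_pos),
    zero_add] at hneg
  linarith

theorem natDegree_eq_of_univ (H : L.SelfAdjointWith polyFunctions univ p) :
    L.a₄.natDegree = 0 ∧ L.a₃.natDegree = 1 := by
  have hneg := H.leadingCoeff_mul_neg_of_Ioi_subset (subset_univ (Ioi 0))
  have hreflect := (H.affine (neg_ne_zero.2 one_ne_zero) 0).leadingCoeff_mul_neg_of_Ioi_subset
    (subset_univ (Ioi 0))
  have hodd : Odd (L.a₃.natDegree + L.a₄.natDegree) := by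
    by_contra heven
    have hpow := (Nat.not_odd_iff_even.1 heven).neg_one_pow (α := ℝ)
    rw [pow_add] at hpow
    simp only [DiffOp4.affine, inv_neg, inv_one, map_neg, map_one, neg_mul, one_mul, map_zero,
      add_zero, even_two, Even.neg_pow, one_pow, map_pow, leadingCoeff_mul, leadingCoeff_pow,
      leadingCoeff_neg, monic_one, Monic.leadingCoeff, comp_neg_X_leadingCoeff_eq] at hreflect
    nlinarith
  obtain ⟨j, hj⟩ := hodd
  have hle := H.natDegree_a₄_le_of_Ioi_subset (subset_univ (Ioi 0))
  rcases H.isFormallySymmetric.natDegree_le H.order_four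
    (H.a₃_ne_zero_of_Ioi_subset (subset_univ (Ioi 0))) hle with h | h <;> lia

theorem exists_scale_eq_quadraticOp_one (H : L.SelfAdjointWith polyFunctions univ p) :
    ∃ κ ≠ 0, ∃ t₀ t₁ c, t₁ < 0 ∧ L.scale κ = quadraticOp 1 (C t₀ + C t₁ * X) c := by
  obtain ⟨hd4, hd3⟩ := H.natDegree_eq_of_univ
  obtain ⟨κ, hκ, τ, h⟩ := exists_hasLeadingSquare_scale (q := 1) H.order_four.1
    (monic_one.pow 2) (by simp) (by simp [hd4]) (one_dvd _)
  have hd : (L.scale κ).a₃.natDegree = (1 : ℝ[X]).natDegree + 1 := by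
    rw [DiffOp4.scale, natDegree_C_mul hκ, hd3, natDegree_one]
  exact ⟨κ, hκ, (H.scale hκ).exists_eq_quadraticOp_of_Ioi_subset (subset_univ (Ioi 0)) h monic_one
    (by simp) hd (one_dvd _)⟩

theorem exists_scale_eq_quadraticOp_X (H : L.SelfAdjointWith polyFunctions (Ioi 0) p) :
    ∃ κ ≠ 0, ∃ t₀ t₁ c, t₁ < 0 ∧ L.scale κ = quadraticOp X (C t₀ + C t₁ * X) c := by
  have hstart : StartsAtZero (Ioi (0 : ℝ)) := .inl rfl
  have h4 := H.eval_a₄_left_end hstart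
  have h4' := H.eval_derivative_a₄_left_end hstart
  have hdvd : X ^ 2 ∣ L.a₄ := by simpa using pow_two_dvd_of_eval_eq_zero h4 h4'
  have h3 : X ∣ L.a₃ := X_dvd_iff.2 (by
    rw [coeff_zero_eq_eval_zero, H.isFormallySymmetric.eval_a₃_eq_zero h4 h4'])
  have hle := H.natDegree_a₄_le_of_Ioi_subset subset_rfl
  have hge := natDegree_le_of_dvd hdvd H.order_four.1
  rw [natDegree_X_pow] at hge
  have hd := H.isFormallySymmetric.natDegree_le H.order_four
    (H.a₃_ne_zero_of_Ioi_subset subset_rfl) hle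
  obtain ⟨κ, hκ, τ, h⟩ := exists_hasLeadingSquare_scale H.order_four.1 (monic_X.pow 2) hdvd
    (by rw [natDegree_X_pow]; lia) h3
  have hd3 : (L.scale κ).a₃.natDegree = (X : ℝ[X]).natDegree + 1 := by
    rw [DiffOp4.scale, natDegree_C_mul hκ, natDegree_X]
    lia
  have hres := (H.scale hκ).eval_residual_left_end hstart h (by simp) (by simp)
  exact ⟨κ, hκ, (H.scale hκ).exists_eq_quadraticOp_of_Ioi_subset subset_rfl h monic_X
    natDegree_X_le hd3 (X_dvd_iff.2 (by rwa [coeff_zero_eq_eval_zero]))⟩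

theorem exists_scale_eq_quadraticOp_one_sub_X_sq
    (H : L.SelfAdjointWith polyFunctions (Ioo (-1) 1) p) :
    ∃ κ ≠ 0, ∃ t₀ t₁ c, L.scale κ = quadraticOp (1 - X ^ 2) (C t₀ + C t₁ * X) c := by
  have hne {e : ℝ} (he : e ^ 2 = 1) : -e ≠ 0 :=
    neg_ne_zero.2 (ne_of_apply_ne (· ^ 2) (by simp [he]))
  have hstart {e : ℝ} := startsAtZero_setOf_mem_Ioo (e := e)
  have h4 {e : ℝ} (he : e ^ 2 = 1) := H.eval_a₄_end (hne he) (hstart he)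
  have h4' {e : ℝ} (he : e ^ 2 = 1) := H.eval_derivative_a₄_end (hne he) (hstart he)
  have hdvd := one_sub_X_sq_pow_dvd fun e he => pow_two_dvd_of_eval_eq_zero (h4 he) (h4' he)
  have hdvd₃ := one_sub_X_sq_pow_dvd (f := L.a₃) (n := 1) fun e he => by
    rw [pow_one, dvd_iff_isRoot]
    exact H.isFormallySymmetric.eval_a₃_eq_zero (h4 he) (h4' he)
  have hdeg : (1 - X ^ 2 : ℝ[X]).natDegree = 2 := by compute_degree!
  obtain ⟨κ, hκ, τ, h⟩ := exists_hasLeadingSquare_scale H.order_four.1 (by monicity!) hdvd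
    (by rw [natDegree_pow, hdeg]; exact H.order_four.2.2.2.2) (by rwa [pow_one] at hdvd₃)
  have hM := H.scale hκ
  have hres := one_sub_X_sq_pow_dvd (f := (L.scale κ).residual (1 - X ^ 2) τ) (n := 1)
    fun e he => by
      rw [pow_one, dvd_iff_isRoot]
      exact hM.eval_residual_end (hne he) (hstart he) h (by simp [he])
        (by simpa using hne he)
  have hτ := h.natDegree_le_one hdeg hM.order_four.2.2.2.1
  obtain ⟨c, hc⟩ := h.exists_eq_quadraticOp_of_natDegree_eq_two hM.isFormallySymmetric
    hM.order_four.2.2.1 hdeg hτ (by rwa [pow_one] at hres)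
  refine ⟨κ, hκ, τ.coeff 0, τ.coeff 1, c, ?_⟩
  rwa [add_comm (C _), ← eq_X_add_C_of_natDegree_le_one hτ]

end SelfAdjointWith

end DiffOp4

section Triples

/-- The triples `(L, I, p)` of the first case of the classification, in the original variable: the
affine changes of variable are absorbed by the parameters. -/
def IsHermiteTriple (L : DiffOp4) (I : Set ℝ) (p : ℝ → ℝ) : Prop :=
  ∃ κ m₀ m₁ m₂ A : ℝ, κ ≠ 0 ∧ m₂ ≠ 0 ∧ L.scale κ = hermiteOp m₁ m₂ A ∧ I = univ ∧
    ∀ x, p x = Real.exp (-m₂ ^ 2 * x ^ 2 + m₁ * x + m₀)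

/-- The triples `(L, I, p)` of the second case of the classification, which take the normal form
after the change of variable `x = r y + s`. -/
def IsLaguerreTriple (L : DiffOp4) (I : Set ℝ) (p : ℝ → ℝ) : Prop :=
  ∃ κ r s c a b A : ℝ, κ ≠ 0 ∧ r ≠ 0 ∧ 0 < c ∧ 2 < a ∧ b < 0 ∧
    (L.affine r s).scale κ = laguerreOp a b A ∧ {y : ℝ | r * y + s ∈ I} = Ioi 0 ∧
    ∀ y ∈ Ioi (0 : ℝ), p (r * y + s) = c * laguerreWeight a b y

/-- The triples `(L, I, p)` of the third case of the classification, which take one of the two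
normal forms after the change of variable `x = r y + s`. -/
def IsJacobiTriple (L : DiffOp4) (I : Set ℝ) (p : ℝ → ℝ) : Prop :=
  ∃ κ r s c : ℝ, κ ≠ 0 ∧ r ≠ 0 ∧ 0 < c ∧ {y : ℝ | r * y + s ∈ I} = Ioo (-1) 1 ∧
    ((∃ a A : ℝ, a < 0 ∧ (L.affine r s).scale κ = gegenbauerOp a A ∧
        ∀ y ∈ Ioo (-1 : ℝ) 1, p (r * y + s) = c * (1 - y ^ 2) ^ (-1 - a / 2)) ∨
      (∃ a b B : ℝ, b ≠ 0 ∧ 0 < b - a ∧ b + a < 0 ∧ (L.affine r s).scale κ = jacobiOp a b B ∧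
        ∀ y ∈ Ioo (-1 : ℝ) 1, p (r * y + s) = c * jacobiWeight a b y))

variable {L : DiffOp4} {I : Set ℝ} {p : ℝ → ℝ}

theorem IsHermiteTriple.selfAdjointWith (h : IsHermiteTriple L I p) :
    L.SelfAdjointWith {f | Function.HasTemperateGrowth f} I p := by
  obtain ⟨κ, m₀, m₁, m₂, A, hκ, hm, hL, rfl, hp⟩ := h
  refine (selfAdjointWith_hermiteOp (m₁ := m₁) A hm).of_affine_scale isTestSpace_hasTemperateGrowth
    (r := 1) (s := 0) one_ne_zero hκ (Real.exp_pos m₀) ?_ rfl fun y _ => ?_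
  · rw [DiffOp4.affine_one_zero, hL]
  · rw [one_mul, add_zero, hp, hermiteWeight, ← Real.exp_add, add_comm m₀]

theorem IsLaguerreTriple.selfAdjointWith (h : IsLaguerreTriple L I p) :
    L.SelfAdjointWith {f | Function.HasTemperateGrowth f} I p := by
  obtain ⟨κ, r, s, c, a, b, A, hκ, hr, hc, ha, hb, hL, hI, hp⟩ := h
  exact (selfAdjointWith_laguerreOp A ha hb).of_affine_scale isTestSpace_hasTemperateGrowth
    hr hκ hc hL hI hp

theorem IsJacobiTriple.selfAdjointWith (h : IsJacobiTriple L I p) :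
    L.SelfAdjointWith {f | Function.HasTemperateGrowth f} I p := by
  obtain ⟨κ, r, s, c, hκ, hr, hc, hI, ⟨a, A, ha, hL, hp⟩ | ⟨a, b, B, hb, hleft, hright, hL, hp⟩⟩ :=
    h
  · rw [gegenbauerOp_eq] at hL
    exact (selfAdjointWith_quadraticOp_jacobi (by rwa [zero_sub, neg_pos]) (by rwa [zero_add])
      _).of_affine_scale isTestSpace_hasTemperateGrowth hr hκ hc hL hI fun y hy => by
        rw [hp y hy, jacobiWeight_zero_right a hy]
  · rw [jacobiOp_eq hb] at hL
    exact (selfAdjointWith_quadraticOp_jacobi hleft hright _).of_affine_scale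
      isTestSpace_hasTemperateGrowth hr hκ hc hL hI hp

theorem DiffOp4.eval_a₄_affine_scale_eq_zero_iff {κ r : ℝ} (hκ : κ ≠ 0) (hr : r ≠ 0) (s y : ℝ) :
    ((L.affine r s).scale κ).a₄.eval y = 0 ↔ L.a₄.eval (r * y + s) = 0 := by
  simp [scale, affine, eval_comp, hκ, hr]

theorem IsHermiteTriple.eval_a₄_ne_zero (h : IsHermiteTriple L I p) (x : ℝ) :
    L.a₄.eval x ≠ 0 := by
  obtain ⟨κ, -, m₁, m₂, A, -, -, hL, -⟩ := h
  intro hx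
  have h4 := congrArg (fun M : DiffOp4 => M.a₄.eval x) hL
  simp [DiffOp4.scale, hermiteOp, hx] at h4

theorem IsLaguerreTriple.existsUnique_eval_a₄_eq_zero (h : IsLaguerreTriple L I p) :
    ∃! x, L.a₄.eval x = 0 := by
  obtain ⟨κ, r, s, -, a, b, A, hκ, hr, -, -, -, hL, -⟩ := h
  have hroot (x : ℝ) : L.a₄.eval x = 0 ↔ r⁻¹ * x + -s / r = 0 := by
    rw [← affine_apply_affine_inv hr s x, ← DiffOp4.eval_a₄_affine_scale_eq_zero_iff hκ hr, hL,
      affine_apply_affine_inv hr]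
    simp [laguerreOp]
  refine ⟨s, (hroot s).2 (by field_simp; ring), fun x hx => ?_⟩
  rw [← affine_apply_affine_inv hr s x, (hroot x).1 hx, mul_zero, zero_add]

theorem IsJacobiTriple.exists_ne_eval_a₄_eq_zero (h : IsJacobiTriple L I p) :
    ∃ x x', x ≠ x' ∧ L.a₄.eval x = 0 ∧ L.a₄.eval x' = 0 := by
  obtain ⟨κ, r, s, c, hκ, hr, -, -, h⟩ := h
  have h4 : ((L.affine r s).scale κ).a₄ = (1 - X ^ 2) ^ 2 := by
    rcases h with ⟨a, A, -, hL, -⟩ | ⟨a, b, B, -, -, -, hL, -⟩ <;> rw [hL] <;> rfl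
  have hroot {e : ℝ} (he : e ^ 2 = 1) : L.a₄.eval (r * e + s) = 0 := by
    rw [← DiffOp4.eval_a₄_affine_scale_eq_zero_iff hκ hr, h4]
    simp [he]
  exact ⟨r * 1 + s, r * (-1) + s, (injective_affine hr s).ne (by norm_num), hroot (by norm_num),
    hroot (by norm_num)⟩

end Triples

namespace DiffOp4.SelfAdjointWith

variable {L : DiffOp4} {I : Set ℝ} {p : ℝ → ℝ} {r s : ℝ}

theorem isHermiteTriple (H : L.SelfAdjointWith polyFunctions univ p) :
    IsHermiteTriple L univ p := by
  obtain ⟨κ, hκ, t₀, t₁, c, ht, hL⟩ := H.exists_scale_eq_quadraticOp_one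
  have hM := H.scale hκ
  have hm : √(-t₁ / 2) ^ 2 = -t₁ / 2 := Real.sq_sqrt (by linarith)
  obtain ⟨A, rfl⟩ : ∃ A, c = A - t₀ ^ 2 + 4 * √(-t₁ / 2) ^ 2 :=
    ⟨c + t₀ ^ 2 - 4 * √(-t₁ / 2) ^ 2, by ring⟩
  have hτ : C t₀ + C t₁ * X = C t₀ - C (2 * √(-t₁ / 2) ^ 2) * X := by
    rw [hm, mul_div_cancel₀ _ (two_ne_zero' ℝ), map_neg, neg_mul, sub_neg_eq_add]
  rw [hτ] at hL
  rw [hL] at hM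
  obtain ⟨k, hk, hp, -⟩ := hM.exists_eq_mul_of_isPearsonWeight (isPearsonWeight_hermite _ _ _)
  refine ⟨κ, Real.log k, t₀, √(-t₁ / 2), A, hκ, (Real.sqrt_pos.2 (by linarith)).ne', ?_, rfl,
    fun x => ?_⟩
  · rw [hL, hermiteOp_eq]
  · rw [hp x (mem_univ x), hermiteWeight, Real.exp_add _ (Real.log k), Real.exp_log hk, mul_comm]

theorem isLaguerreTriple (H : L.SelfAdjointWith polyFunctions I p) (hr : r ≠ 0)
    (hI : {y | r * y + s ∈ I} = Ioi 0) : IsLaguerreTriple L I p := by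
  have hM := H.affine hr s
  rw [hI] at hM
  obtain ⟨κ, hκ, t₀, t₁, c, ht, hL⟩ := hM.exists_scale_eq_quadraticOp_X
  replace hM := hM.scale hκ
  obtain ⟨a, rfl⟩ : ∃ a, t₀ = (a - 2) / 2 := ⟨2 * t₀ + 2, by ring⟩
  obtain ⟨b, rfl⟩ : ∃ b, t₁ = b / 2 := ⟨2 * t₁, by ring⟩
  obtain ⟨A, rfl⟩ : ∃ A, c = A - a * b / 2 - b / 2 := ⟨c + a * b / 2 + b / 2, by ring⟩
  rw [hL] at hM
  obtain ⟨k, hk, hp, hadm⟩ := hM.exists_eq_mul_of_isPearsonWeight (isPearsonWeight_laguerre _ _)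
  have hb : b < 0 := by linarith
  exact ⟨κ, r, s, k, a, b, A, hκ, hr, hk, (admissibleWeight_laguerre_iff hb).1 hadm, hb,
    by rw [hL, laguerreOp_eq], hI, hp⟩

theorem isJacobiTriple (H : L.SelfAdjointWith polyFunctions I p) (hr : r ≠ 0)
    (hI : {y | r * y + s ∈ I} = Ioo (-1) 1) : IsJacobiTriple L I p := by
  have hM := H.affine hr s
  rw [hI] at hM
  obtain ⟨κ, hκ, b, a, c, hL⟩ := hM.exists_scale_eq_quadraticOp_one_sub_X_sq
  replace hM := hM.scale hκ
  rw [hL] at hM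
  obtain ⟨k, hk, hp, hadm⟩ := hM.exists_eq_mul_of_isPearsonWeight (isPearsonWeight_jacobi _ _)
  obtain ⟨hleft, hright⟩ := admissibleWeight_jacobi_iff.1 hadm
  refine ⟨κ, r, s, k, hκ, hr, hk, hI, ?_⟩
  rcases eq_or_ne b 0 with rfl | hb
  · obtain ⟨A, rfl⟩ : ∃ A, c = 2 - 4 * a + a ^ 2 - A := ⟨2 - 4 * a + a ^ 2 - c, by ring⟩
    exact .inl ⟨a, A, by linarith, by rw [hL, gegenbauerOp_eq], fun y hy => by
      rw [hp y hy, jacobiWeight_zero_right a hy]⟩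
  · obtain ⟨B, rfl⟩ : ∃ B, c = B / b - a := ⟨b * (c + a), by field_simp; ring⟩
    exact .inr ⟨a, b, B, hb, hleft, hright, by rw [hL, jacobiOp_eq hb], hp⟩

theorem isHermiteTriple_or_isLaguerreTriple_or_isJacobiTriple
    (H : L.SelfAdjointWith polyFunctions I p) :
    IsHermiteTriple L I p ∨ IsLaguerreTriple L I p ∨ IsJacobiTriple L I p := by
  rcases exists_eq_Ioi_or_Iio_or_Ioo_or_univ H.isOpen
    ⟨H.nonempty, H.ordConnected.isPreconnected⟩ with rfl | ⟨d, rfl⟩ | ⟨e, rfl⟩ | ⟨d, e, rfl⟩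
  · exact .inl H.isHermiteTriple
  · exact .inr (.inl (H.isLaguerreTriple (s := d) one_ne_zero (by ext; simp)))
  · exact .inr (.inl (H.isLaguerreTriple (r := -1) (s := e) (by norm_num) (by ext; simp)))
  · have hlt : d < e := nonempty_Ioo.1 H.nonempty
    refine .inr (.inr (H.isJacobiTriple (r := (e - d) / 2) (s := (d + e) / 2)
      (by linarith [sub_pos.2 hlt]) ?_))
    ext y
    simp only [mem_ofPred_eq, mem_Ioo]
    constructor <;> rintro ⟨h₁, h₂⟩ <;> constructor <;> nlinarith

end DiffOp4.SelfAdjointWith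

theorem DiffOp4.selfAdjointWith_iff {𝒟 : Set (ℝ → ℝ)} (hpoly : polyFunctions ⊆ 𝒟)
    (hgrowth : 𝒟 ⊆ {f | Function.HasTemperateGrowth f}) {L : DiffOp4} {I : Set ℝ} {p : ℝ → ℝ} :
    L.SelfAdjointWith 𝒟 I p ↔
      IsHermiteTriple L I p ∨ IsLaguerreTriple L I p ∨ IsJacobiTriple L I p := by
  refine ⟨fun H => (H.mono hpoly).isHermiteTriple_or_isLaguerreTriple_or_isJacobiTriple, ?_⟩
  rintro (h | h | h) <;> exact h.selfAdjointWith.mono hgrowth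

end

theorem mainTheorem8 :
    -- the classification, for any space `𝒟` of smooth functions of temperate growth that contains
    -- the polynomials
    (∀ (𝒟 : Set (ℝ → ℝ)), (∀ q : ℝ[X], (fun x => q.eval x) ∈ 𝒟) →
      (∀ f ∈ 𝒟, Function.HasTemperateGrowth f) →
      ∀ (L : DiffOp4) (I : Set ℝ) (p : ℝ → ℝ),
      -- no real root
      ((∀ x, L.a₄.eval x ≠ 0) →
        (L.SelfAdjointWith 𝒟 I p ↔
          ∃ κ m₀ m₁ m₂ A : ℝ, κ ≠ 0 ∧ m₂ ≠ 0 ∧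
            L.scale κ = hermiteOp m₁ m₂ A ∧ I = univ ∧
            ∀ x, p x = Real.exp (-m₂ ^ 2 * x ^ 2 + m₁ * x + m₀))) ∧
      -- exactly one real root
      ((∃! x, L.a₄.eval x = 0) →
        (L.SelfAdjointWith 𝒟 I p ↔
          ∃ κ r s c a b A : ℝ, κ ≠ 0 ∧ r ≠ 0 ∧ 0 < c ∧ 2 < a ∧ b < 0 ∧
            (L.affine r s).scale κ = laguerreOp a b A ∧
            {y : ℝ | r * y + s ∈ I} = Ioi 0 ∧
            ∀ y ∈ Ioi (0 : ℝ),
              p (r * y + s) = c * (|y| ^ (a / 2 - 2) * Real.exp (b / 2 * y)))) ∧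
      -- more than one real root
      ((∃ x x', x ≠ x' ∧ L.a₄.eval x = 0 ∧ L.a₄.eval x' = 0) →
        (L.SelfAdjointWith 𝒟 I p ↔
          ∃ κ r s c : ℝ, κ ≠ 0 ∧ r ≠ 0 ∧ 0 < c ∧
            {y : ℝ | r * y + s ∈ I} = Ioo (-1) 1 ∧
            ((∃ a A : ℝ, a < 0 ∧ (L.affine r s).scale κ = gegenbauerOp a A ∧
                ∀ y ∈ Ioo (-1 : ℝ) 1, p (r * y + s) = c * (1 - y ^ 2) ^ (-1 - a / 2)) ∨
              (∃ a b B : ℝ, b ≠ 0 ∧ 0 < b - a ∧ b + a < 0 ∧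
                (L.affine r s).scale κ = jacobiOp a b B ∧
                ∀ y ∈ Ioo (-1 : ℝ) 1, p (r * y + s) =
                  c * ((1 - y) ^ ((-2 - a - b) / 2) * (1 + y) ^ ((-2 - a + b) / 2))))))) ∧
    -- the eigenvalues
    (∀ m₁ m₂ A : ℝ, m₂ ≠ 0 → (hermiteOp m₁ m₂ A).HasEigenvalues
      (fun n => 2 * m₂ ^ 2 * (m₁ ^ 2 - A + 2 * m₂ ^ 2 * ((n : ℝ) - 2)) * n)) ∧
    (∀ a b A : ℝ, 2 < a → b < 0 → (laguerreOp a b A).HasEigenvalues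
      (fun n => b / 4 * n * (2 * A - a * b - b + b * n))) ∧
    (∀ a A : ℝ, a < 0 → (gegenbauerOp a A).HasEigenvalues
      (fun n => n * (-a + n - 1) * (-a ^ 2 - n * a + 4 * a + (n : ℝ) ^ 2 + A - n - 2))) ∧
    (∀ a b B : ℝ, b ≠ 0 → 0 < b - a → b + a < 0 → (jacobiOp a b B).HasEigenvalues
      (fun n => (a - n + 1) * n * (-b * (n : ℝ) ^ 2 + a * b * n + b * n - a * b + B) / b)) := by
  refine ⟨fun 𝒟 hpoly hgrowth L I p => ?_, fun _ _ A hm => hasEigenvalues_hermiteOp _ A hm,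
    fun _ _ A ha hb => hasEigenvalues_laguerreOp A ha hb,
    fun _ A ha => hasEigenvalues_gegenbauerOp A ha,
    fun _ _ B hb hleft hright => hasEigenvalues_jacobiOp B hb hleft hright⟩
  have key : L.SelfAdjointWith 𝒟 I p ↔
      IsHermiteTriple L I p ∨ IsLaguerreTriple L I p ∨ IsJacobiTriple L I p :=
    DiffOp4.selfAdjointWith_iff (by rintro _ ⟨q, rfl⟩; exact hpoly q) hgrowth
  refine ⟨fun hno => key.trans ⟨?_, .inl⟩, fun hone => key.trans ⟨?_, fun h => .inr (.inl h)⟩,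
    fun htwo => key.trans ⟨?_, fun h => .inr (.inr h)⟩⟩
  · rintro (h | h | h)
    · exact h
    · exact (h.existsUnique_eval_a₄_eq_zero.exists.elim hno).elim
    · obtain ⟨x, -, -, hx, -⟩ := h.exists_ne_eval_a₄_eq_zero
      exact (hno x hx).elim
  · rintro (h | h | h)
    · exact (hone.exists.elim h.eval_a₄_ne_zero).elim
    · exact h
    · obtain ⟨x, x', hne, hx, hx'⟩ := h.exists_ne_eval_a₄_eq_zero
      exact (hne (hone.unique hx hx')).elim
  · obtain ⟨x, x', hne, hx, hx'⟩ := htwo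
    rintro (h | h | h)
    · exact (h.eval_a₄_ne_zero x hx).elim
    · exact (hne (h.existsUnique_eval_a₄_eq_zero.unique hx hx')).elim
    · exact h
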